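/- Write $(a;q)_n=\prod_{i=1}^{n}(1-aq^{i-1})$, $(a;q)_0=1$, and let $v_0(n)$ be defined by $$\sum_{n\ge 0} v_0(n)q^n=\sum_{n\ge 0}\frac{q^{n^2}(-q;q^2)_n}{(q;q^2)_n},$$ so that $V_0(q)=-1+2\sum_{n\ge0}v_0(n)q^n$ is the eighth order mock theta function of Gordon and McIntosh. Let $$\varphi(q)=\sum_{n=-\infty}^{\infty}q^{n^2},\qquad \psi(q)=\sum_{n=0}^{\infty}q^{n(n+1)/2}.$$ Define infinite matrices $(m_{i,j})$, $(n_{i,j})$, $(p_{i,j})$, $i,j\ge 1$, as follows. - $m_{1,1}=1$, $m_{1,j}=0$ for $j\ge2$; $m_{2,1}=-1$, $m_{2,2}=2$, $m_{2,j}=0$ for $j\ge 3$; $m_{i,1}=0$ for $i\ge3$; $m_{i,j}=2m_{i-1,j-1}-m_{i-2,j-1}$ for $i\ge3$, $j\ge2$. - $n_{1,1}=2$, $n_{1,j}=0$ for $j\ge2$; $n_{2,1}=1$, $n_{2,2}=8$, $n_{2,j}=0$ for $j\ge 3$; $n_{i,1}=0$ for $i\ge3$; $n_{i,j}=4n_{i-1,j-1}+n_{i-2,j-1}$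 for $i\ge3$, $j\ge2$. - $p_{1,1}=4$, $p_{1,j}=0$ for $j\ge2$; $p_{2,1}=1$, $p_{2,2}=32$, $p_{2,j}=0$ for $j\ge 3$; $p_{i,1}=0$ for $i\ge3$; $p_{i,j}=8p_{i-1,j-1}+p_{i-2,j-1}$ for $i\ge3$, $j\ge2$. Put $a_{i,j}=m_{2i-1,\,j+i-1}$ and $c_{i,j}=n_{2i-1,\,j+i-1}$, and define, with indices $i,j\ge1$, $$A=(a_{4i-3,\,j}),\quad B=(b_{i,j}),\quad C=(c_{4i-3,\,j}),\quad D=(d_{i,j}),$$ where $b_{1,1}=d_{1,1}=1$, $b_{k,1}=b_{1,k}=d_{k,1}=d_{1,k}=0$ for $k>1$, and $b_{i,j}=m_{i-1,j-1}$, $d_{i,j}=p_{i-1,j-1}$ for $i,j\ge2$. Define the (finitely supported) row vectors $\mathbf x_\alpha=(x_{\alpha,j})_{j\ge1}$, $\mathbf y_\alpha=(y_{\alpha,j})_{j\ge1}$, $\mathbf z_\alpha=(z_{\alpha,j})_{j\ge1}$ for $\alpha\ge1$ by $\mathbf x_1=(-\tfrac32,2,0,0,\dots)$ and $$\mathbf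 x_{2\alpha}=\mathbf x_{2\alpha-1}A,\quad \mathbf x_{2\alpha+1}=\mathbf x_{2\alpha}B,\quad \mathbf y_\alpha=\mathbf x_{2\alpha-1}C,\quad \mathbf z_\alpha=\mathbf y_\alpha D\qquad(\alpha\ge1).$$ **Theorem.** For every integer $\alpha\ge1$, the following identities of formal power series in $q$ hold: $$\frac12+\sum_{n=1}^\infty v_0(2^{2\alpha+2}n)q^n=\sum_{j\ge1}x_{2\alpha-1,j}\,\frac{\varphi(q)^{4j-3}}{\varphi(-q)^{4j-4}},$$ $$\frac12+\sum_{n=1}^\infty v_0(2^{2\alpha+3}n)q^n=\sum_{j\ge1}x_{2\alpha,j}\,\frac{\varphi(q^2)^{2j-1}}{\varphi(-q)^{2j-2}},$$ $$\sum_{n=0}^\infty v_0\big(2^{2\alpha+2}(2n+1)\big)q^n=\sum_{j\ge1}y_{\alpha,j}\,q^{j-1}\frac{\psi(q^4)^{2j-1}}{\varphi(-q)^{2j-2}},$$ $$\sum_{n=0}^\infty v_0\big(2^{2\alpha+2}(4n+1)\big)q^n=\sum_{j\ge1}z_{\alpha,j}\,q^{j-1}\frac{\psi(q^2)^{4j-3}}{\varphi(-q)^{4j-4}}.$$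 -/

import Mathlib

open scoped PowerSeries

namespace MockV0

noncomputable section

/-! ## The sequence `v₀(n)` -/

/-- The finite `q`-shifted factorial `(a; q)_n = ∏_{i=1}^n (1 - a q^{i-1})` for formal power
series `a`, `q`. -/
def qPoch (a q : ℤ⟦X⟧) (n : ℕ) : ℤ⟦X⟧ :=
  ∏ i ∈ Finset.range n, (1 - a * q ^ i)

/-- The `n`-th summand `q^{n²} (-q; q²)_n / (q; q²)_n`. The denominator has constant
coefficient `1`, and `PowerSeries.invOfUnit _ 1` is its inverse in `ℤ⟦X⟧`
(see `qPoch_mul_invOfUnit`). -/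
def v0Term (n : ℕ) : ℤ⟦X⟧ :=
  PowerSeries.X ^ n ^ 2 * qPoch (-PowerSeries.X) (PowerSeries.X ^ 2) n *
    PowerSeries.invOfUnit (qPoch PowerSeries.X (PowerSeries.X ^ 2) n) 1

/-- `v₀(N)` is the coefficient of `q^N` in `∑_{n ≥ 0} q^{n²} (-q; q²)_n / (q; q²)_n`.
Only the summands with `n ≤ N` contribute to this coefficient (see `coeff_v0Term`). -/
def v0 (N : ℕ) : ℤ :=
  ∑ n ∈ Finset.range (N + 1), PowerSeries.coeff N (v0Term n)

theorem qPoch_mul_invOfUnit (n : ℕ) :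
    qPoch PowerSeries.X (PowerSeries.X ^ 2) n *
      PowerSeries.invOfUnit (qPoch PowerSeries.X (PowerSeries.X ^ 2) n) 1 = 1 := by
  apply PowerSeries.mul_invOfUnit
  simp [qPoch, map_prod]

theorem coeff_v0Term {N n : ℕ} (h : N < n) : PowerSeries.coeff N (v0Term n) = 0 := by
  have h' : ¬ n ^ 2 ≤ N := by nlinarith
  rw [v0Term, mul_assoc, PowerSeries.coeff_X_pow_mul', if_neg h']

/-! ## Ramanujan's theta functions -/

/-- `φ(q) = ∑_{k ∈ ℤ} q^{k²}`: the coefficient of `q^n` is the number of integers `k` with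
`k² = n`. -/
def phi : ℚ⟦X⟧ :=
  PowerSeries.mk fun n => (Set.ncard {k : ℤ | k ^ 2 = (n : ℤ)} : ℚ)

/-- `ψ(q) = ∑_{k ≥ 0} q^{k(k+1)/2}`: the coefficient of `q^n` is the number of natural numbers
`k` with `k(k+1)/2 = n`. -/
def psi : ℚ⟦X⟧ :=
  PowerSeries.mk fun n => (Set.ncard {k : ℕ | k * (k + 1) / 2 = n} : ℚ)

/-- `φ(-q)`. -/
def phiNeg : ℚ⟦X⟧ := PowerSeries.evalNegHom phi

/-- `φ(q²)`. -/
def phi2 : ℚ⟦X⟧ := PowerSeries.expand 2 (by norm_num) phi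

/-- `ψ(q²)`. -/
def psi2 : ℚ⟦X⟧ := PowerSeries.expand 2 (by norm_num) psi

/-- `ψ(q⁴)`. -/
def psi4 : ℚ⟦X⟧ := PowerSeries.expand 4 (by norm_num) psi

/-- The denominator series `φ(-q)` has constant coefficient `1`, so it is invertible. -/
theorem constantCoeff_phiNeg : PowerSeries.constantCoeff phiNeg = 1 := by
  have h : {k : ℤ | k ^ 2 = ((0 : ℕ) : ℤ)} = {0} := by
    ext k
    simp
  rw [← PowerSeries.coeff_zero_eq_constantCoeff_apply, phiNeg, PowerSeries.evalNegHom,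
    PowerSeries.coeff_rescale, phi, PowerSeries.coeff_mk, h]
  simp

/-! ## The matrices

All matrices are indexed by `i, j ≥ 1`; the entries with an index `0` are never used. -/

/-- The matrix `M = (m_{i,j})`. -/
def mMat : ℕ → ℕ → ℤ
  | 1, 1 => 1
  | 2, 1 => -1
  | 2, 2 => 2
  | i + 3, j + 2 => 2 * mMat (i + 2) (j + 1) - mMat (i + 1) (j + 1)
  | _, _ => 0

/-- The matrix `N = (n_{i,j})`. -/
def nMat : ℕ → ℕ → ℤ
  | 1, 1 => 2
  | 2, 1 => 1
  | 2, 2 => 8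
  | i + 3, j + 2 => 4 * nMat (i + 2) (j + 1) + nMat (i + 1) (j + 1)
  | _, _ => 0

/-- The matrix `P = (p_{i,j})`. -/
def pMat : ℕ → ℕ → ℤ
  | 1, 1 => 4
  | 2, 1 => 1
  | 2, 2 => 32
  | i + 3, j + 2 => 8 * pMat (i + 2) (j + 1) + pMat (i + 1) (j + 1)
  | _, _ => 0

/-- `a_{i,j} = m_{2i-1, j+i-1}`. -/
def aCoef (i j : ℕ) : ℤ := mMat (2 * i - 1) (j + i - 1)

/-- `c_{i,j} = n_{2i-1, j+i-1}`. -/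
def cCoef (i j : ℕ) : ℤ := nMat (2 * i - 1) (j + i - 1)

/-- `A = (a_{4i-3, j})`. -/
def matA (i j : ℕ) : ℤ := aCoef (4 * i - 3) j

/-- `B = (b_{i,j})` with `b_{1,1} = 1`, `b_{k,1} = b_{1,k} = 0` for `k > 1`, and
`b_{i,j} = m_{i-1,j-1}` for `i, j ≥ 2`. -/
def matB : ℕ → ℕ → ℤ
  | 1, 1 => 1
  | i + 2, j + 2 => mMat (i + 1) (j + 1)
  | _, _ => 0

/-- `C = (c_{4i-3, j})`. -/
def matC (i j : ℕ) : ℤ := cCoef (4 * i - 3) j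

/-- `D = (d_{i,j})` with `d_{1,1} = 1`, `d_{k,1} = d_{1,k} = 0` for `k > 1`, and
`d_{i,j} = p_{i-1,j-1}` for `i, j ≥ 2`. -/
def matD : ℕ → ℕ → ℤ
  | 1, 1 => 1
  | i + 2, j + 2 => pMat (i + 1) (j + 1)
  | _, _ => 0

/-! ## The coefficient vectors -/

/-- The product of the row vector `(u_i)_{i ≥ 1}` with the matrix `(M_{i,j})_{i, j ≥ 1}`. All
vectors below have finite support (see `finite_support_xVec`, `finite_support_yVec`,
`finite_support_zVec`), so this is a genuine finite sum. -/
def rowMul (u : ℕ → ℚ) (M : ℕ → ℕ → ℤ) (j : ℕ) : ℚ :=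
  ∑ᶠ i ∈ Set.Ici 1, u i * (M i j : ℚ)

/-- The vectors `x_α`, `α ≥ 1`: `x_1 = (-3/2, 2, 0, 0, …)`, `x_{2α} = x_{2α-1} A` and
`x_{2α+1} = x_{2α} B`. The value at `α = 0` is never used. -/
def xVec : ℕ → ℕ → ℚ
  | 0 => 0
  | 1 => fun j => if j = 1 then -3 / 2 else if j = 2 then 2 else 0
  | n + 2 => if Even n then rowMul (xVec (n + 1)) matA else rowMul (xVec (n + 1)) matB

/-- `y_α = x_{2α-1} C`. -/
def yVec (α : ℕ) : ℕ → ℚ := rowMul (xVec (2 * α - 1)) matC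

/-- `z_α = y_α D`. -/
def zVec (α : ℕ) : ℕ → ℚ := rowMul (yVec α) matD

theorem xVec_two_mul {α : ℕ} (h : 1 ≤ α) : xVec (2 * α) = rowMul (xVec (2 * α - 1)) matA := by
  obtain ⟨k, rfl⟩ := Nat.exists_eq_add_of_le' h
  rw [show 2 * (k + 1) = 2 * k + 2 by ring, xVec, if_pos (even_two_mul k)]
  rfl

theorem xVec_two_mul_add_one {α : ℕ} (h : 1 ≤ α) :
    xVec (2 * α + 1) = rowMul (xVec (2 * α)) matB := by
  obtain ⟨k, rfl⟩ := Nat.exists_eq_add_of_le' h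
  rw [show 2 * (k + 1) + 1 = (2 * k + 1) + 2 by ring, xVec, if_neg (by simp)]
  rfl

/-! ### Finiteness of supports -/

theorem mMat_eq_zero (i j : ℕ) (h : i < j) : mMat i j = 0 := by
  fun_induction mMat i j with
  | case4 i j h1 h2 => rw [h1 (by omega), h2 (by omega)]; rfl
  | case5 => rfl
  | _ => omega

theorem nMat_eq_zero (i j : ℕ) (h : i < j) : nMat i j = 0 := by
  fun_induction nMat i j with
  | case4 i j h1 h2 => rw [h1 (by omega), h2 (by omega)]; rfl
  | case5 => rfl
  | _ => omega

theorem pMat_eq_zero (i j : ℕ) (h : i < j) : pMat i j = 0 := by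
  fun_induction pMat i j with
  | case4 i j h1 h2 => rw [h1 (by omega), h2 (by omega)]; rfl
  | case5 => rfl
  | _ => omega

theorem matA_eq_zero (i j : ℕ) (hi : 1 ≤ i) (h : 4 * i < j) : matA i j = 0 :=
  mMat_eq_zero _ _ (by omega)

theorem matC_eq_zero (i j : ℕ) (hi : 1 ≤ i) (h : 4 * i < j) : matC i j = 0 :=
  nMat_eq_zero _ _ (by omega)

theorem matB_eq_zero (i j : ℕ) (_ : 1 ≤ i) (h : 4 * i < j) : matB i j = 0 := by
  fun_cases matB i j
  · omega
  · exact mMat_eq_zero _ _ (by omega)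
  · rfl

theorem matD_eq_zero (i j : ℕ) (_ : 1 ≤ i) (h : 4 * i < j) : matD i j = 0 := by
  fun_cases matD i j
  · omega
  · exact pMat_eq_zero _ _ (by omega)
  · rfl

theorem finite_support_rowMul {u : ℕ → ℚ} {M : ℕ → ℕ → ℤ} (hu : u.support.Finite)
    (hM : ∀ i j, 1 ≤ i → 4 * i < j → M i j = 0) : (rowMul u M).support.Finite := by
  obtain ⟨b, hb⟩ := hu.bddAbove
  refine (Set.finite_Iic (4 * b)).subset fun j hj => ?_
  by_contra hlt
  refine hj (finsum_mem_eq_zero_of_forall_eq_zero fun i h0 => ?_)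
  by_cases hi : u i = 0
  · simp [hi]
  · have h1 : i ≤ b := hb hi
    simp only [Set.mem_Iic, not_le] at hlt
    simp [hM i j h0 (by omega)]

theorem finite_support_xVec (α : ℕ) : (xVec α).support.Finite := by
  induction α using xVec.induct with
  | case1 => simp [xVec]
  | case2 =>
    refine (Set.finite_Iic 2).subset fun j hj => ?_
    by_contra hlt
    simp only [Set.mem_Iic, not_le] at hlt
    exact hj (by simp [xVec, show j ≠ 1 by omega, show j ≠ 2 by omega])
  | case3 n _ ih =>
    rw [xVec]
    split_ifs
    exact finite_support_rowMul ih matA_eq_zero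
  | case4 n _ ih =>
    rw [xVec]
    split_ifs
    exact finite_support_rowMul ih matB_eq_zero

theorem finite_support_yVec (α : ℕ) : (yVec α).support.Finite :=
  finite_support_rowMul (finite_support_xVec _) matC_eq_zero

theorem finite_support_zVec (α : ℕ) : (zVec α).support.Finite :=
  finite_support_rowMul (finite_support_yVec _) matD_eq_zero

end

end MockV0

/-!
The series `∑_{n ≥ 0} v₀(n) qⁿ` is first reduced to theta functions, and the theorem then follows by
repeated bisection `∑ aₙ qⁿ ↦ ∑ a₂ₙ qⁿ`, `∑ aₙ qⁿ ↦ ∑ a₂ₙ₊₁ qⁿ` of quotients of theta functions.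

**The even part of `v₀`.** Put `tₙ(q) = q^{n²} (-q; q²)ₙ / (q; q²)ₙ` for all `n ∈ ℤ`. Then
`t₋ₙ(q) = tₙ(-q)`, so that `F(q) = ∑_{n ∈ ℤ} tₙ(q) = -1 + 2 ∑ v₀(2n) q^{2n}`. The claim is that
`F(q) φ(-q⁴) = φ(q²)²`, which is `v0Series_one_mul_phiNeg` after replacing `q²` by `q`. Consider
the polynomial in `x`
`x^M ∏_{j < M} (x + q^{2j+1})(1 - q^{2j+1} x) · ∑_{|n| ≤ M} q^{n²} xⁿ (-xq; q²)ₙ / (xq; q²)ₙ`,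
denoted `Q_M(x)` (`bilatPoly`). It satisfies a functional equation relating `Q_M(q² x)` to `Q_M(x)`
with an error term divisible by `q^M` (`bilatPoly_shift`). Comparing coefficients, those at
`x^{2M ± 2c}` are `q^{2c²}` times the central one modulo `q^M`, and the central coefficient is
exactly `∏_{j < M} (1 + q^{4j+2})` (`coeff_bilatPoly_center`). As `Q_M(1) = Q_M(-1)` is `(q²; q⁴)_M`
times the truncated series `F`, this gives `(q²; q⁴)_M F(q) ≡ (-q²; q⁴)_M φ(q²)` modulo `q^M`
(`X_pow_dvd_prod_mul_v0Series`). The same argument for the finite triple product, evaluated at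
`x = ±1`, gives `(-q²; q⁴)_M² φ(-q²) ≡ (q²; q⁴)_M² φ(q²)` (`X_pow_dvd_prod_sq_mul_phiNeg`).
Eliminating the products and using `φ(q) φ(-q) = φ(-q²)²` yields `(F(q) φ(-q⁴))² = φ(q²)⁴`, and the
sign of the square root is read off from the constant term. Working with truncations keeps
everything polynomial: no infinite product, and no analytic continuation in `x`, is needed.

**Bisection.** From `φ(q) = φ(q⁴) + 2q ψ(q⁸)` and `φ(q)² = φ(q²)² + 4q ψ(q⁴)²` (`phi_eq`, `phi_sq`)
the sums and products of `x = φ(q)` and `y = ±φ(-q)`, or of their squares, are known. Hence the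
power sums `x^k + y^k`, which are the even or odd parts to be computed, satisfy a two-term linear
recurrence, and this is the recurrence that defines the matrices `(m_{i,j})`, `(n_{i,j})`,
`(p_{i,j})` (`IsLucasMatrix.pow_mul_add`). So bisection maps the four families of theta
quotients in the theorem to each other through the matrices `A`, `C`, `B`, `D` (`bisect_phiQuot`,
`bisectOdd_phiQuot`, `bisect_phi2Quot`, `bisect_psi4Quot`). Three bisections of
`φ(q)² / (2 φ(-q²))` give `-3/2 φ(q) + 2 φ(q)⁵ / φ(-q)⁴` (`v0Series_four`), which is the vector
`x₁`, and induction on `α` finishes the proof.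
-/

namespace MockV0

noncomputable section

/-! ### Finite forms of the triple product and of the bilateral series -/

section FiniteForms

open Polynomial

variable {R : Type*} [CommRing R]

/-- The finite triple product `∏_{j < M} (s x + q^{2j+1})(1 + s q^{2j+1} x)` in the variable `x`.
For `s = ±1` it is, up to a factor `(s x)^M`, the product of Jacobi with `x` replaced by `s x`. -/
def tripleProd (q s : R) (M : ℕ) : R[X] :=
  ∏ j ∈ Finset.range M, (C s * X + C (q ^ (2 * j + 1))) * (1 + C (s * q ^ (2 * j + 1)) * X)

theorem tripleProd_succ (q s : R) (M : ℕ) :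
    tripleProd q s (M + 1) = tripleProd q s M *
      ((C s * X + C (q ^ (2 * M + 1))) * (1 + C (s * q ^ (2 * M + 1)) * X)) :=
  Finset.prod_range_succ _ _

/-- The quasi-periodicity of the finite triple product under `x ↦ q² x`. -/
theorem tripleProd_shift (q s : R) (M : ℕ) :
    (C (q * s) * X + C (q ^ (2 * M))) * (tripleProd q s M).comp (C (q ^ 2) * X) =
      C (q ^ (2 * M)) * (1 + C (s * q ^ (2 * M + 1)) * X) * tripleProd q s M := by
  induction M with
  | zero => simp [tripleProd]; ring
  | succ M ih =>
    rw [tripleProd_succ]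
    simp only [mul_comp, add_comp, C_comp, X_comp, one_comp] at ih ⊢
    simp only [map_pow, map_mul] at ih ⊢
    linear_combination (C q * C s * X + C q ^ (2 * M + 2)) * C q *
      (1 + C s * C q ^ (2 * M + 3) * X) * ih

/-- The truncated bilateral series with its denominators cleared: the polynomial
`x^M ∏_{j < M} (x + q^{2j+1})(1 - q^{2j+1} x) · ∑_{|n| ≤ M} q^{n²} xⁿ (-xq; q²)ₙ / (xq; q²)ₙ`
of degree at most `4M`. It is defined by recursion on `M`; the two triple products are the
contributions of the summands with `n = M + 1` and `n = -(M + 1)`. -/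
def bilatPoly (q : R) : ℕ → R[X]
  | 0 => 1
  | M + 1 => X * (X + C (q ^ (2 * M + 1))) * (1 - C (q ^ (2 * M + 1)) * X) * bilatPoly q M +
      C (q ^ (M + 1) ^ 2) *
        (X ^ (2 * M + 2) * tripleProd q 1 (M + 1) + tripleProd q (-1) (M + 1))

/-- The functional equation of the truncated bilateral series under `x ↦ q² x`. The last two
products form the boundary term `bilatDefect`, which comes from the ends `n = ±M` of the range of
summation. The powers `X ^ 1` and the grouping of the factors are chosen for reading off
coefficients. -/
theorem bilatPoly_shift (q : R) (M : ℕ) :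
    C (q ^ 2) * (X ^ 2 * (bilatPoly q M).comp (C (q ^ 2) * X)) +
        C (q ^ (2 * M + 1)) * (X ^ 1 * (bilatPoly q M).comp (C (q ^ 2) * X)) =
      C (q ^ (4 * M)) * (bilatPoly q M - C (q ^ (2 * M + 1)) * (X ^ 1 * bilatPoly q M) +
        (C (q ^ (M + 1) ^ 2) *
            (X ^ (2 * M + 1) * (tripleProd q 1 M * (1 + C (q ^ (2 * M + 1)) * X))) -
          C (q ^ M ^ 2) * (tripleProd q (-1) M * (1 - C (q ^ (2 * M + 1)) * X)))) := by
  induction M with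
  | zero => simp [tripleProd, bilatPoly]; ring
  | succ M ih =>
    have h1 := tripleProd_shift q 1 M
    have h2 := tripleProd_shift q (-1) M
    rw [bilatPoly, tripleProd_succ, tripleProd_succ]
    simp only [mul_comp, add_comp, sub_comp, X_pow_comp, C_comp, X_comp, one_comp] at ih h1 h2 ⊢
    simp only [map_pow, map_mul, map_neg, map_one] at ih h1 h2 ⊢
    linear_combination C q ^ 3 * X * (C q * X + C q ^ (2 * M + 2)) *
        (1 - C q ^ (2 * M + 3) * X) * ih +
      C q * X * (C q * X + C q ^ (2 * M + 2)) * C q ^ (M + 1) ^ 2 *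
        (C q ^ 2 * X) ^ (2 * M + 2) * C q * (1 + C q ^ (2 * M + 3) * X) * h1 +
      C q * X * (C q * X + C q ^ (2 * M + 2)) * C q ^ (M + 1) ^ 2 * C q *
        (1 - C q ^ (2 * M + 3) * X) * h2

theorem natDegree_tripleProd_le (q s : R) (M : ℕ) : (tripleProd q s M).natDegree ≤ 2 * M := by
  induction M with
  | zero => simp [tripleProd]
  | succ M ih =>
    rw [tripleProd_succ]
    have h1 : (C s * X + C (q ^ (2 * M + 1))).natDegree ≤ 1 := by compute_degree
    have h2 : (1 + C (s * q ^ (2 * M + 1)) * X).natDegree ≤ 1 := by compute_degree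
    have h3 := natDegree_mul_le_of_le ih (natDegree_mul_le_of_le h1 h2)
    omega

theorem natDegree_bilatPoly_le (q : R) (M : ℕ) : (bilatPoly q M).natDegree ≤ 4 * M := by
  induction M with
  | zero => simp [bilatPoly]
  | succ M ih =>
    rw [bilatPoly]
    have h1 := natDegree_tripleProd_le q 1 (M + 1)
    have h2 := natDegree_tripleProd_le q (-1) (M + 1)
    have h3 : (X * (X + C (q ^ (2 * M + 1))) * (1 - C (q ^ (2 * M + 1)) * X)).natDegree ≤ 3 := by
      compute_degree
    have h4 : (X ^ (2 * M + 2) * tripleProd q 1 (M + 1)).natDegree ≤ 4 * (M + 1) :=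
      (natDegree_mul_le_of_le (natDegree_X_pow_le _) h1).trans (by omega)
    exact natDegree_add_le_of_degree_le
      ((natDegree_mul_le_of_le h3 ih).trans (by omega))
      ((natDegree_C_mul_le _ _).trans (natDegree_add_le_of_degree_le h4 (by omega)))

theorem coeff_zero_tripleProd (q s : R) (M : ℕ) : (tripleProd q s M).coeff 0 = q ^ M ^ 2 := by
  induction M with
  | zero => simp [tripleProd]
  | succ M ih =>
    rw [tripleProd_succ, mul_coeff_zero, ih]
    simp [mul_coeff_zero, -map_pow]
    ring

theorem coeff_two_mul_tripleProd (q s : R) (M : ℕ) :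
    (tripleProd q s M).coeff (2 * M) = s ^ (2 * M) * q ^ M ^ 2 := by
  induction M with
  | zero => simp [tripleProd]
  | succ M ih =>
    have h1 : (C s * X + C (q ^ (2 * M + 1))).natDegree ≤ 1 := by compute_degree
    have h2 : (1 + C (s * q ^ (2 * M + 1)) * X).natDegree ≤ 1 := by compute_degree
    rw [tripleProd_succ, show 2 * (M + 1) = 2 * M + (1 + 1) by ring,
      coeff_mul_add_eq_of_natDegree_le (natDegree_tripleProd_le q s M)
        (natDegree_mul_le_of_le h1 h2), ih, coeff_mul_add_eq_of_natDegree_le h1 h2]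
    simp [coeff_one, coeff_C, -map_pow]
    ring

/-- `tripleProd_shift` at `s = 1`, read off coefficientwise. -/
theorem coeff_tripleProd_rec (q : R) (M k : ℕ) :
    q ^ (2 * k + 1) * (tripleProd q 1 M).coeff k +
        q ^ (2 * M + 2 * k + 2) * (tripleProd q 1 M).coeff (k + 1) =
      q ^ (2 * M) * ((tripleProd q 1 M).coeff (k + 1) +
        q ^ (2 * M + 1) * (tripleProd q 1 M).coeff k) := by
  have h : C q * (X * (tripleProd q 1 M).comp (C (q ^ 2) * X)) +
      C (q ^ (2 * M)) * (tripleProd q 1 M).comp (C (q ^ 2) * X) =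
      C (q ^ (2 * M)) * (tripleProd q 1 M + C (q ^ (2 * M + 1)) * (X * tripleProd q 1 M)) := by
    have := tripleProd_shift q 1 M
    simp only [mul_one, one_mul] at this
    linear_combination this
  have h := congrArg (coeff · (k + 1)) h
  simp only [coeff_add, coeff_C_mul, coeff_X_mul, comp_C_mul_X_coeff] at h
  rw [← h]
  ring

/-- The boundary term in the functional equation `bilatPoly_shift`. -/
def bilatDefect (q : R) (M : ℕ) : R[X] :=
  C (q ^ (M + 1) ^ 2) * (X ^ (2 * M + 1) * (tripleProd q 1 M * (1 + C (q ^ (2 * M + 1)) * X))) -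
    C (q ^ M ^ 2) * (tripleProd q (-1) M * (1 - C (q ^ (2 * M + 1)) * X))

theorem C_pow_dvd_bilatDefect (q : R) (M : ℕ) : C (q ^ M) ∣ bilatDefect q M := by
  refine dvd_sub ?_ ?_ <;> refine Dvd.dvd.mul_right (map_dvd C (pow_dvd_pow q ?_)) _ <;> nlinarith

/-- The coefficient of the boundary term that is needed next to the centre, where divisibility by
`q^M` would not suffice. -/
theorem coeff_bilatDefect (q : R) (M : ℕ) :
    (bilatDefect q M).coeff (2 * M + 1) = 2 * q ^ (M ^ 2 + (M + 1) ^ 2) := by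
  have h2 : (1 - C (q ^ (2 * M + 1)) * X).natDegree ≤ 1 := by compute_degree
  rw [bilatDefect, coeff_sub, coeff_C_mul, coeff_C_mul,
    coeff_mul_add_eq_of_natDegree_le (natDegree_tripleProd_le q (-1) M) h2,
    coeff_two_mul_tripleProd, coeff_X_pow_mul', if_pos le_rfl, Nat.sub_self, mul_coeff_zero,
    coeff_zero_tripleProd]
  simp [coeff_one, coeff_C, -map_pow]
  ring

/-- `bilatPoly_shift`, read off coefficientwise. -/
theorem coeff_bilatPoly_rec (q : R) (M k : ℕ) :
    q ^ (2 * k + 2) * (bilatPoly q M).coeff k +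
        q ^ (2 * M + 2 * k + 3) * (bilatPoly q M).coeff (k + 1) =
      q ^ (4 * M) * ((bilatPoly q M).coeff (k + 2) - q ^ (2 * M + 1) * (bilatPoly q M).coeff (k + 1)
        + (bilatDefect q M).coeff (k + 2)) := by
  have h := congrArg (coeff · (k + 2)) (bilatPoly_shift q M)
  have e (p : R[X]) : (X ^ 1 * p).coeff (k + 2) = p.coeff (k + 1) := coeff_X_pow_mul p 1 (k + 1)
  rw [← bilatDefect] at h
  simp only [coeff_add, coeff_sub, coeff_C_mul, e, coeff_X_pow_mul,
    comp_C_mul_X_coeff] at h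
  rw [← h]
  ring

/-- Indexing of the coefficients by their distance from the central one. -/
theorem sum_range_eq_sum_Icc (M : ℕ) (f : ℕ → R) :
    ∑ i ∈ Finset.range (2 * M + 1), f i = ∑ k ∈ Finset.Icc (-M : ℤ) M, f (k + M).toNat := by
  refine Finset.sum_nbij' (fun i => (i : ℤ) - M) (fun k => (k + M).toNat) ?_ ?_ ?_ ?_ ?_ <;>
    intro i hi <;> simp only [Finset.mem_range, Finset.mem_Icc] at * <;> try omega
  congr 1
  omega

theorem eval_one_add_eval_neg_one (p : R[X]) (n : ℕ) (h : p.natDegree ≤ 2 * n) :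
    p.eval 1 + p.eval (-1) = 2 * ∑ i ∈ Finset.range (n + 1), p.coeff (2 * i) := by
  rw [eval_eq_sum_range' (n := 2 * (n + 1)) (by omega),
    eval_eq_sum_range' (n := 2 * (n + 1)) (by omega)]
  generalize n + 1 = m
  induction m with
  | zero => simp
  | succ m ih =>
    rw [show 2 * (m + 1) = 2 * m + 1 + 1 by ring, Finset.sum_range_succ, Finset.sum_range_succ,
      Finset.sum_range_succ _ (2 * m + 1), Finset.sum_range_succ _ (2 * m),
      Finset.sum_range_succ _ m, mul_add, ← ih, pow_succ (-1 : R), pow_mul (-1 : R), neg_one_sq]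
    simp only [one_pow]
    ring

theorem eval_one_tripleProd_neg_one (q : R) (M : ℕ) :
    (tripleProd q (-1) M).eval 1 = (tripleProd q 1 M).eval (-1) := by
  simp [tripleProd, eval_prod]

theorem eval_neg_one_tripleProd_neg_one (q : R) (M : ℕ) :
    (tripleProd q (-1) M).eval (-1) = (tripleProd q 1 M).eval 1 := by
  simp [tripleProd, eval_prod]

theorem eval_one_bilatPoly_succ (q : R) (M : ℕ) :
    (bilatPoly q (M + 1)).eval 1 = (1 - q ^ (4 * M + 2)) * (bilatPoly q M).eval 1 +
      q ^ (M + 1) ^ 2 * ((tripleProd q 1 (M + 1)).eval 1 + (tripleProd q 1 (M + 1)).eval (-1)) := by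
  rw [bilatPoly]
  simp only [eval_add, eval_mul, eval_sub, eval_X, eval_C, eval_one, eval_pow, one_pow,
    eval_one_tripleProd_neg_one]
  ring

/-- The symmetry of the truncated bilateral series which makes its values at `±1` agree, so that its
even coefficients suffice to compute them. -/
theorem eval_neg_one_bilatPoly (q : R) (M : ℕ) :
    (bilatPoly q M).eval (-1) = (bilatPoly q M).eval 1 := by
  induction M with
  | zero => simp [bilatPoly]
  | succ M ih =>
    rw [eval_one_bilatPoly_succ, bilatPoly]
    simp only [eval_add, eval_mul, eval_sub, eval_X, eval_C, eval_one, eval_pow,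
      eval_neg_one_tripleProd_neg_one, ih]
    rw [show 2 * M + 2 = 2 * (M + 1) by ring, (even_two_mul _).neg_one_pow]
    ring

variable [IsDomain R]

/-- To the right of the centre, the coefficients of the triple product are `q^{j²}` times the
central one, modulo `q^M`. -/
theorem pow_dvd_coeff_tripleProd_add {q : R} (hq : q ≠ 0) (M j : ℕ) :
    q ^ M ∣ (tripleProd q 1 M).coeff (M + j) - q ^ j ^ 2 * (tripleProd q 1 M).coeff M := by
  induction j with
  | zero => simp
  | succ j ih =>
    have h := coeff_tripleProd_rec q M (M + j)
    obtain ⟨r, hr⟩ := ih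
    set c := (tripleProd q 1 M).coeff
    have h' : c (M + j + 1) = q ^ (2 * j + 1) * c (M + j) +
        q ^ M * (q ^ (M + 2 * j + 2) * c (M + j + 1) - q ^ (M + 1) * c (M + j)) := by
      apply mul_left_cancel₀ (pow_ne_zero (2 * M) hq)
      linear_combination -h
    refine ⟨q ^ (2 * j + 1) * r +
      (q ^ (M + 2 * j + 2) * c (M + j + 1) - q ^ (M + 1) * c (M + j)), ?_⟩
    rw [← add_assoc]
    linear_combination h' + q ^ (2 * j + 1) * hr

/-- To the left of the centre, the coefficients of the triple product are `q^{j²}` times the central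
one, modulo `q^M`. -/
theorem pow_dvd_coeff_tripleProd_sub {q : R} (hq : q ≠ 0) (M j : ℕ) (hj : j ≤ M) :
    q ^ M ∣ (tripleProd q 1 M).coeff (M - j) - q ^ j ^ 2 * (tripleProd q 1 M).coeff M := by
  induction j with
  | zero => simp
  | succ j ih =>
    obtain ⟨k, rfl⟩ := Nat.exists_eq_add_of_le' hj
    have h := coeff_tripleProd_rec q (k + (j + 1)) k
    obtain ⟨r, hr⟩ := ih (by omega)
    rw [show k + (j + 1) - j = k + 1 by omega] at hr
    rw [show k + (j + 1) - (j + 1) = k by omega]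
    set c := (tripleProd q 1 (k + (j + 1))).coeff
    have h' : c k = q ^ (2 * j + 1) * c (k + 1) + q ^ (k + (j + 1)) *
        (q ^ (2 * j + 1 + (k + (j + 1)) + 1) * c k - q ^ (k + (j + 1) + 1) * c (k + 1)) := by
      apply mul_left_cancel₀ (pow_ne_zero (2 * k + 1) hq)
      linear_combination h
    refine ⟨q ^ (2 * j + 1) * r +
      (q ^ (2 * j + 1 + (k + (j + 1)) + 1) * c k - q ^ (k + (j + 1) + 1) * c (k + 1)), ?_⟩
    linear_combination h' + q ^ (2 * j + 1) * hr

/-- The central coefficient of the truncated bilateral series. Unlike for the other coefficients, an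
exact formula is available. -/
theorem coeff_bilatPoly_center {q : R} (hq : q ≠ 0) (M : ℕ) :
    (bilatPoly q M).coeff (2 * M) = ∏ j ∈ Finset.range M, (1 + q ^ (4 * j + 2)) := by
  induction M with
  | zero => simp [bilatPoly]
  | succ M ih =>
    rw [Finset.prod_range_succ, ← ih]
    have e : bilatPoly q (M + 1) = C (q ^ (2 * M + 1)) * (X ^ 1 * bilatPoly q M) +
        C (1 - q ^ (4 * M + 2)) * (X ^ 2 * bilatPoly q M) -
        C (q ^ (2 * M + 1)) * (X ^ 3 * bilatPoly q M) + C (q ^ (M + 1) ^ 2) *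
        (X ^ (2 * M + 2) * tripleProd q 1 (M + 1) + tripleProd q (-1) (M + 1)) := by
      rw [bilatPoly]
      simp only [map_pow, map_sub, map_one]
      ring
    rw [e]
    simp only [coeff_add, coeff_sub, coeff_C_mul]
    have e0 : (X ^ (2 * M + 2) * tripleProd q 1 (M + 1)).coeff (2 * (M + 1)) = q ^ (M + 1) ^ 2 := by
      rw [coeff_X_pow_mul', if_pos (by omega), show 2 * (M + 1) - (2 * M + 2) = 0 by omega,
        coeff_zero_tripleProd]
    rw [e0, coeff_two_mul_tripleProd, (even_two_mul _).neg_one_pow]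
    -- The recursion brings in the two neighbours of the old centre, and the coefficientwise
    -- functional equation evaluates their difference.
    obtain _ | N := M
    · simp [bilatPoly, coeff_X_pow, coeff_X, coeff_one]
      ring
    · have h := coeff_bilatPoly_rec q (N + 1) (2 * N + 1)
      rw [show 2 * N + 1 + 2 = 2 * (N + 1) + 1 by ring, coeff_bilatDefect,
        show 2 * N + 1 + 1 = 2 * (N + 1) by ring] at h
      rw [show 2 * (N + 1 + 1) = (2 * (N + 1) + 1) + 1 by ring, coeff_X_pow_mul,
        show 2 * (N + 1) + 1 + 1 = 2 * (N + 1) + 2 by ring, coeff_X_pow_mul,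
        show 2 * (N + 1) + 2 = (2 * N + 1) + 3 by ring, coeff_X_pow_mul]
      set c := (bilatPoly q (N + 1)).coeff
      have h' : c (2 * (N + 1) + 1) - c (2 * N + 1) = 2 * q ^ (2 * N + 3) * c (2 * (N + 1)) -
          2 * q ^ ((N + 1) ^ 2 + (N + 1 + 1) ^ 2) := by
        apply mul_left_cancel₀ (pow_ne_zero (4 * (N + 1)) hq)
        linear_combination -h
      linear_combination q ^ (2 * N + 3) * h'

/-- To the right of the centre, the even coefficients of `bilatPoly` are `q^{2j²}` times the central
one, modulo `q^M`. The functional equation links neighbouring coefficients, but the contribution of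
the odd ones is divisible by `q^M`. -/
theorem pow_dvd_coeff_bilatPoly_add {q : R} (hq : q ≠ 0) (M j : ℕ) :
    q ^ M ∣ (bilatPoly q M).coeff (2 * (M + j)) -
      q ^ (2 * j ^ 2) * (bilatPoly q M).coeff (2 * M) := by
  induction j with
  | zero => simp
  | succ j ih =>
    have h := coeff_bilatPoly_rec q M (2 * (M + j))
    obtain ⟨r, hr⟩ := ih
    obtain ⟨d, hd⟩ := C_pow_dvd_bilatDefect q M
    rw [hd, coeff_C_mul] at h
    rw [show 2 * (M + (j + 1)) = 2 * (M + j) + 2 by ring]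
    set c := (bilatPoly q M).coeff
    generalize d.coeff _ = d at h
    have h' : c (2 * (M + j) + 2) = q ^ (4 * j + 2) * c (2 * (M + j)) +
        q ^ M * ((q ^ (M + 4 * j + 3) + q ^ (M + 1)) * c (2 * (M + j) + 1) - d) := by
      apply mul_left_cancel₀ (pow_ne_zero (4 * M) hq)
      linear_combination -h
    refine ⟨q ^ (4 * j + 2) * r +
      ((q ^ (M + 4 * j + 3) + q ^ (M + 1)) * c (2 * (M + j) + 1) - d), ?_⟩
    linear_combination h' + q ^ (4 * j + 2) * hr

/-- To the left of the centre, the even coefficients of `bilatPoly` are `q^{2j²}` times the central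
one, modulo `q^M`. -/
theorem pow_dvd_coeff_bilatPoly_sub {q : R} (hq : q ≠ 0) (M j : ℕ) (hj : j ≤ M) :
    q ^ M ∣ (bilatPoly q M).coeff (2 * (M - j)) -
      q ^ (2 * j ^ 2) * (bilatPoly q M).coeff (2 * M) := by
  induction j with
  | zero => simp
  | succ j ih =>
    obtain ⟨k, rfl⟩ := Nat.exists_eq_add_of_le' hj
    have h := coeff_bilatPoly_rec q (k + (j + 1)) (2 * k)
    obtain ⟨r, hr⟩ := ih (by omega)
    obtain ⟨d, hd⟩ := C_pow_dvd_bilatDefect q (k + (j + 1))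
    rw [hd, coeff_C_mul] at h
    rw [show 2 * (k + (j + 1) - j) = 2 * k + 2 by omega] at hr
    rw [show k + (j + 1) - (j + 1) = k by omega]
    set c := (bilatPoly q (k + (j + 1))).coeff
    generalize d.coeff _ = d at h
    have h' : c (2 * k) = q ^ (4 * j + 2) * c (2 * k + 2) + q ^ (k + (j + 1)) *
        (q ^ (4 * j + 2) * d - (q ^ (k + j + 2) + q ^ (k + 5 * j + 4)) * c (2 * k + 1)) := by
      apply mul_left_cancel₀ (pow_ne_zero (4 * k + 2) hq)
      linear_combination h
    refine ⟨q ^ (4 * j + 2) * r +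
      (q ^ (4 * j + 2) * d - (q ^ (k + j + 2) + q ^ (k + 5 * j + 4)) * c (2 * k + 1)), ?_⟩
    linear_combination h' + q ^ (4 * j + 2) * hr

/-- The truncated triple product at `x = 1` is a multiple of the truncated series `φ(q)`, modulo
`q^M`. -/
theorem pow_dvd_eval_one_tripleProd {q : R} (hq : q ≠ 0) (M : ℕ) :
    q ^ M ∣ (tripleProd q 1 M).eval 1 -
      (tripleProd q 1 M).coeff M * ∑ k ∈ Finset.Icc (-M : ℤ) M, q ^ k.natAbs ^ 2 := by
  rw [eval_eq_sum_range' (Nat.lt_succ_of_le (natDegree_tripleProd_le q 1 M)), Nat.succ_eq_add_one,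
    sum_range_eq_sum_Icc, Finset.mul_sum, ← Finset.sum_sub_distrib]
  refine Finset.dvd_sum fun k hk => ?_
  rw [Finset.mem_Icc] at hk
  rw [one_pow, mul_one, mul_comm]
  obtain ⟨j, rfl | rfl⟩ := k.eq_nat_or_neg
  · rw [show ((j : ℤ) + M).toNat = M + j by omega]
    exact pow_dvd_coeff_tripleProd_add hq M j
  · rw [show (-(j : ℤ) + M).toNat = M - j by omega, Int.natAbs_neg]
    exact pow_dvd_coeff_tripleProd_sub hq M j (by omega)

/-- The truncated triple product at `x = -1` is, up to sign, the same multiple of the truncated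
series `φ(-q)`, modulo `q^M`. -/
theorem pow_dvd_eval_neg_one_tripleProd {q : R} (hq : q ≠ 0) (M : ℕ) :
    q ^ M ∣ (-1) ^ M * (tripleProd q 1 M).eval (-1) - (tripleProd q 1 M).coeff M *
      ∑ k ∈ Finset.Icc (-M : ℤ) M, (-1) ^ k.natAbs * q ^ k.natAbs ^ 2 := by
  rw [eval_eq_sum_range' (Nat.lt_succ_of_le (natDegree_tripleProd_le q 1 M)), Nat.succ_eq_add_one,
    sum_range_eq_sum_Icc, Finset.mul_sum, Finset.mul_sum, ← Finset.sum_sub_distrib]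
  refine Finset.dvd_sum fun k hk => ?_
  rw [Finset.mem_Icc] at hk
  have e (c : R) (b : ℕ) (i : ℕ) (hb : Even (M + i + b)) :
      (-1) ^ M * (c * (-1) ^ i) = (-1) ^ b * c := by
    have := hb.neg_one_pow (α := R)
    have h2 : ((-1 : R) ^ b) * (-1) ^ b = 1 := by rw [← mul_pow]; simp
    rw [pow_add, pow_add] at this
    linear_combination c * (-1) ^ b * this - (-1) ^ M * (-1) ^ i * c * h2
  obtain ⟨j, rfl | rfl⟩ := k.eq_nat_or_neg
  · rw [show ((j : ℤ) + M).toNat = M + j by omega, Int.natAbs_natCast,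
      e _ j _ (by rw [Nat.even_iff]; omega), mul_left_comm, ← mul_sub]
    rw [mul_comm (coeff _ M)]
    exact (pow_dvd_coeff_tripleProd_add hq M j).mul_left _
  · rw [show (-(j : ℤ) + M).toNat = M - j by omega, Int.natAbs_neg, Int.natAbs_natCast,
      e _ j _ (by rw [Nat.even_iff]; omega), mul_left_comm, ← mul_sub]
    rw [mul_comm (coeff _ M)]
    exact (pow_dvd_coeff_tripleProd_sub hq M j (by omega)).mul_left _

/-- Adding the values at `±1` isolates the even coefficients, and these form the truncated series
`φ(q²)`. -/
theorem pow_dvd_eval_bilatPoly {q : R} (hq : q ≠ 0) (M : ℕ) :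
    q ^ M ∣ (bilatPoly q M).eval 1 + (bilatPoly q M).eval (-1) -
      2 * ((∏ j ∈ Finset.range M, (1 + q ^ (4 * j + 2))) *
        ∑ k ∈ Finset.Icc (-M : ℤ) M, q ^ (2 * k.natAbs ^ 2)) := by
  rw [eval_one_add_eval_neg_one _ (2 * M) ((natDegree_bilatPoly_le q M).trans (by omega)),
    sum_range_eq_sum_Icc, ← mul_sub, Finset.mul_sum, ← Finset.sum_sub_distrib,
    ← coeff_bilatPoly_center hq]
  refine (Finset.dvd_sum fun k hk => ?_).mul_left _
  rw [Finset.mem_Icc] at hk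
  rw [mul_comm (coeff _ _)]
  obtain ⟨j, rfl | rfl⟩ := k.eq_nat_or_neg
  · rw [show ((j : ℤ) + M).toNat = M + j by omega]
    exact pow_dvd_coeff_bilatPoly_add hq M j
  · rw [show (-(j : ℤ) + M).toNat = M - j by omega, Int.natAbs_neg]
    exact pow_dvd_coeff_bilatPoly_sub hq M j (by omega)

end FiniteForms

/-! ### Theta series as sums over the integers -/

section Theta

open PowerSeries
open scoped PowerSeries.WithPiTopology

/-- A family of monomials in which every exponent occurs finitely often sums to the series that
counts the exponents. -/
theorem hasSum_X_pow {ι : Type*} (e : ι → ℕ) (he : ∀ n, {i | e i ≤ n}.Finite) :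
    HasSum (fun i => (X : ℚ⟦X⟧) ^ e i) (mk fun n => (Set.ncard {i | e i = n} : ℚ)) := by
  rw [WithPiTopology.hasSum_iff_hasSum_coeff]
  intro n
  have hf : {i | e i = n}.Finite := (he n).subset fun i hi => le_of_eq hi
  simp only [coeff_X_pow, coeff_mk]
  have h : ∑ i ∈ hf.toFinset, (if n = e i then (1 : ℚ) else 0) = (Set.ncard {i | e i = n} : ℚ) := by
    rw [Finset.sum_congr rfl (g := fun _ => (1 : ℚ))]
    · simp [Set.ncard_eq_toFinset_card _ hf]
    · intro i hi
      rw [Set.Finite.mem_toFinset] at hi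
      exact if_pos hi.symm
  rw [← h]
  refine hasSum_sum_of_ne_finset_zero fun i hi => ?_
  rw [Set.Finite.mem_toFinset] at hi
  exact if_neg (Ne.symm hi)

/-- A sum may be split over two complementary, injectively parametrized parts of the index set. -/
theorem hasSum_of_isCompl_range {ι κ : Type*} {f : κ → ℚ⟦X⟧} {u v : ι → κ} {a b : ℚ⟦X⟧}
    (hu : Function.Injective u) (hv : Function.Injective v)
    (huv : ∀ k, (k ∈ Set.range u ↔ k ∉ Set.range v))
    (ha : HasSum (f ∘ u) a) (hb : HasSum (f ∘ v) b) : HasSum f (a + b) := by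
  refine (hu.hasSum_range_iff.2 ha).add_isCompl ?_ (hv.hasSum_range_iff.2 hb)
  rw [show Set.range u = (Set.range v)ᶜ from Set.ext huv]
  exact isCompl_compl.symm

theorem hasSum_expand {ι : Type*} {g : ι → ℚ⟦X⟧} {f : ℚ⟦X⟧} (h : HasSum g f) (p : ℕ) (hp : p ≠ 0) :
    HasSum (fun i => expand p hp (g i)) (expand p hp f) := by
  rw [WithPiTopology.hasSum_iff_hasSum_coeff] at h ⊢
  intro n
  simp only [coeff_expand]
  split_ifs
  · exact h _
  · exact hasSum_zero

theorem hasSum_evalNegHom {ι : Type*} {g : ι → ℚ⟦X⟧} {f : ℚ⟦X⟧} (h : HasSum g f) :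
    HasSum (fun i => evalNegHom (g i)) (evalNegHom f) := by
  rw [WithPiTopology.hasSum_iff_hasSum_coeff] at h ⊢
  intro n
  simp only [evalNegHom, coeff_rescale]
  exact (h n).mul_left _

/-- `HasSum.mul_left`, restated so that `HasSum` carries the instances on `ℚ⟦X⟧` found by
elaboration. -/
theorem hasSum_mul_left {ι : Type*} {g : ι → ℚ⟦X⟧} {f : ℚ⟦X⟧} (h : HasSum g f) (c : ℚ⟦X⟧) :
    HasSum (fun i => c * g i) (c * f) :=
  h.mul_left c

theorem hasSum_mul {ι κ : Type*} {e : ι → ℚ⟦X⟧} {d : κ → ℚ⟦X⟧} {f g : ℚ⟦X⟧}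
    (hf : HasSum e f) (hg : HasSum d g) (h : Summable fun p : ι × κ => e p.1 * d p.2) :
    HasSum (fun p : ι × κ => e p.1 * d p.2) (f * g) := by
  -- `HasSum.mul` requires a `T3Space`, which is not found by instance search here.
  have : RegularSpace ℚ⟦X⟧ := IsTopologicalAddGroup.regularSpace _
  have : T3Space ℚ⟦X⟧ := ⟨⟩
  exact HasSum.mul (α := ℚ⟦X⟧) hf hg h

theorem hasSum_X_pow_mul {ι κ : Type*} {e : ι → ℕ} {d : κ → ℕ} {f g : ℚ⟦X⟧}
    (he : ∀ n, {i | e i ≤ n}.Finite) (hd : ∀ n, {i | d i ≤ n}.Finite)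
    (hf : HasSum (fun i => X ^ e i) f) (hg : HasSum (fun i => X ^ d i) g) :
    HasSum (fun p : ι × κ => X ^ (e p.1 + d p.2)) (f * g) := by
  have hsum := (hasSum_X_pow (fun p : ι × κ => e p.1 + d p.2) fun n =>
    ((he n).prod (hd n)).subset fun p hp => by
      simp only [Set.mem_ofPred_eq] at hp
      constructor <;> simp only [Set.mem_ofPred_eq] <;> omega).summable
  simp only [pow_add] at hsum ⊢
  exact hasSum_mul (e := fun i => X ^ e i) (d := fun i => X ^ d i) hf hg hsum

/-- A sum is congruent modulo `X ^ M` to any finite partial sum that contains all summands not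
divisible by `X ^ M`. -/
theorem X_pow_dvd_sub_sum {ι : Type*} {g : ι → ℚ⟦X⟧} {f : ℚ⟦X⟧} (h : HasSum g f) (M : ℕ)
    (s : Finset ι) (hs : ∀ i ∉ s, X ^ M ∣ g i) : X ^ M ∣ f - ∑ i ∈ s, g i := by
  rw [X_pow_dvd_iff]
  intro n hn
  rw [WithPiTopology.hasSum_iff_hasSum_coeff] at h
  have := (h n).unique (hasSum_sum_of_ne_finset_zero (s := s)
    fun i hi => X_pow_dvd_iff.1 (hs i hi) n hn)
  rw [map_sub, map_sum, this, sub_self]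

theorem finite_natAbs_le (n : ℕ) : {k : ℤ | k.natAbs ≤ n}.Finite :=
  (Set.finite_Icc (-n : ℤ) n).subset fun k hk => by
    simp only [Set.mem_ofPred_eq, Set.mem_Icc] at *
    omega

theorem finite_natAbs_sq_le (n : ℕ) : {k : ℤ | k.natAbs ^ 2 ≤ n}.Finite :=
  (finite_natAbs_le n).subset fun k (hk : k.natAbs ^ 2 ≤ n) => by
    simp only [Set.mem_ofPred_eq]
    nlinarith

theorem hasSum_phi : HasSum (fun k : ℤ => X ^ k.natAbs ^ 2) phi := by
  convert hasSum_X_pow (fun k : ℤ => k.natAbs ^ 2) finite_natAbs_sq_le using 1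
  rw [phi]
  congr! 5 with n k
  zify
  simp

theorem hasSum_phiNeg : HasSum (fun k : ℤ => (-1) ^ k.natAbs * X ^ k.natAbs ^ 2) phiNeg := by
  rw [phiNeg]
  convert hasSum_evalNegHom hasSum_phi using 2 with k
  rw [map_pow, evalNegHom_X, neg_pow X]
  congr 1
  obtain h | h := Nat.even_or_odd k.natAbs
  · rw [h.neg_one_pow, (h.pow_of_ne_zero two_ne_zero).neg_one_pow]
  · rw [h.neg_one_pow, h.pow.neg_one_pow]

/-- The triangular number `k (k + 1) / 2` of an integer `k`. It is nonnegative, so `Int.toNat` loses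
nothing. -/
def triangular (k : ℤ) : ℕ := (k * (k + 1) / 2).toNat

theorem two_mul_triangular (k : ℤ) : (2 * triangular k : ℤ) = k * (k + 1) := by
  have h : 0 ≤ k * (k + 1) := by
    obtain h | h : 0 ≤ k ∨ k + 1 ≤ 0 := by omega
    · positivity
    · exact mul_nonneg_of_nonpos_of_nonpos (by omega) h
  have h2 : 2 ∣ k * (k + 1) := (Int.even_mul_succ_self k).two_dvd
  rw [triangular]
  omega

theorem finite_triangular_le (n : ℕ) : {k : ℤ | triangular k ≤ n}.Finite :=
  (finite_natAbs_le (2 * n + 1)).subset fun k (hk : triangular k ≤ n) => by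
    have := two_mul_triangular k
    simp only [Set.mem_ofPred_eq]
    zify at hk ⊢
    rw [abs_le]
    constructor <;> nlinarith

/-- Over all integers the exponents `k (k + 1) / 2` run through every triangular number twice,
because `k ↦ -k - 1` preserves them. -/
theorem hasSum_psi : HasSum (fun k : ℤ => X ^ triangular k) (2 * psi) := by
  have e (k : ℕ) : triangular k = k * (k + 1) / 2 := by
    zify
    have := two_mul_triangular k
    omega
  have h : HasSum (fun k : ℕ => X ^ triangular k) psi := by
    convert hasSum_X_pow (fun k : ℕ => triangular k) ?_ using 1
    · simp only [psi, e]
    · intro n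
      exact (finite_triangular_le n).preimage (Nat.cast_injective (R := ℤ)).injOn
  rw [two_mul]
  refine HasSum.of_nat_of_neg_add_one h ?_
  convert h using 3 with k
  zify
  have h1 := two_mul_triangular k
  have h2 := two_mul_triangular (-(k + 1))
  linarith

theorem hasSum_expand_X_pow {ι : Type*} {e : ι → ℕ} {f : ℚ⟦X⟧} (h : HasSum (fun i => X ^ e i) f)
    (p : ℕ) (hp : p ≠ 0) : HasSum (fun i => X ^ (p * e i)) (expand p hp f) := by
  convert hasSum_expand h p hp using 2 with i
  rw [map_pow, expand_X, pow_mul]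

/-- `φ(q) = φ(q⁴) + 2q ψ(q⁸)`: the even and the odd `k` in `∑ q^{k²}`. -/
theorem phi_eq : phi = expand 4 (by norm_num) phi + 2 * X * expand 8 (by norm_num) psi := by
  refine hasSum_phi.unique (hasSum_of_isCompl_range (u := fun k : ℤ => 2 * k)
    (v := fun k : ℤ => 2 * k + 1) (fun _ _ h => by simpa using h) (fun _ _ h => by simpa using h)
    (fun k => ?_) ?_ ?_)
  · simp only [Set.mem_range]
    constructor
    · rintro ⟨y, rfl⟩ ⟨z, h⟩
      omega
    · intro h
      by_contra h'
      exact h ⟨k / 2, by have : 2 * (k / 2) ≠ k := fun e => h' ⟨_, e⟩; omega⟩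
  · convert hasSum_expand_X_pow hasSum_phi 4 (by norm_num) using 2 with k
    simp only [Function.comp_apply, Int.natAbs_mul]
    congr 1
    simp
    ring
  · have h := hasSum_mul_left (hasSum_expand_X_pow hasSum_psi 8 (by norm_num)) X
    rw [map_mul, map_ofNat, mul_left_comm, ← mul_assoc] at h
    convert h using 1
    funext k
    rw [← pow_succ', Function.comp_apply]
    congr 1
    have := two_mul_triangular k
    zify
    rw [sq_abs]
    linarith

/-- `φ(q)² = φ(q²)² + 4q ψ(q⁴)²`: the pairs in `∑ q^{a² + b²}` with `a + b` even are
`(c + d, c - d)`, and those with `a + b` odd are `(c + d + 1, c - d)`. -/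
theorem phi_sq : phi ^ 2 = phi2 ^ 2 + 4 * X * psi4 ^ 2 := by
  have h := hasSum_X_pow_mul finite_natAbs_sq_le finite_natAbs_sq_le hasSum_phi hasSum_phi
  have fin (p : ℕ) (hp : p ≠ 0) {e : ℤ → ℕ} (he : ∀ n, {i | e i ≤ n}.Finite) (n : ℕ) :
      {i | p * e i ≤ n}.Finite :=
    (he n).subset fun i (hi : p * e i ≤ n) =>
      (Nat.le_mul_of_pos_left _ (Nat.pos_of_ne_zero hp)).trans hi
  have h2 := hasSum_expand_X_pow hasSum_phi 2 (by norm_num)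
  have h4 := hasSum_expand_X_pow hasSum_psi 4 (by norm_num)
  have h2' := hasSum_X_pow_mul (fin 2 (by norm_num) finite_natAbs_sq_le)
    (fin 2 (by norm_num) finite_natAbs_sq_le) h2 h2
  have h4' := hasSum_mul_left (hasSum_X_pow_mul (fin 4 (by norm_num) finite_triangular_le)
    (fin 4 (by norm_num) finite_triangular_le) h4 h4) X
  let u : ℤ × ℤ → ℤ × ℤ := fun p => (p.1 + p.2, p.1 - p.2)
  let v : ℤ × ℤ → ℤ × ℤ := fun p => (p.1 + p.2 + 1, p.1 - p.2)
  have hu : Function.Injective u := fun p p' hp => by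
    simp only [u, Prod.mk.injEq] at hp
    ext <;> omega
  have hv : Function.Injective v := fun p p' hp => by
    simp only [v, Prod.mk.injEq] at hp
    ext <;> omega
  have huv (k : ℤ × ℤ) : k ∈ Set.range u ↔ k ∉ Set.range v := by
    constructor
    · rintro ⟨p, rfl⟩ ⟨p', hp⟩
      simp only [u, v, Prod.mk.injEq] at hp
      omega
    · intro hk
      obtain ⟨a, b⟩ := k
      obtain h | h : 2 ∣ a + b ∨ 2 ∣ a + b - 1 := by omega
      · exact ⟨((a + b) / 2, (a - b) / 2), by ext <;> simp only [u] <;> omega⟩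
      · exact absurd ⟨((a + b) / 2, (a - b) / 2), by ext <;> simp only [v] <;> omega⟩ hk
  have := hasSum_of_isCompl_range (f := fun p : ℤ × ℤ => X ^ (p.1.natAbs ^ 2 + p.2.natAbs ^ 2))
    hu hv huv (a := phi2 * phi2) (b := X * ((2 * psi4) * (2 * psi4))) ?_ ?_
  · rw [sq, h.unique this]
    ring
  · convert h2' using 1
    · funext p
      rw [Function.comp_apply]
      congr 1
      zify
      simp only [u, sq_abs]
      ring
    · rfl
  · rw [map_mul, map_ofNat] at h4'
    convert h4' using 1
    · funext p
      rw [← pow_succ', Function.comp_apply]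
      congr 1
      have h1 := two_mul_triangular p.1
      have h2 := two_mul_triangular p.2
      zify
      simp only [v, sq_abs]
      linarith
    · rfl

end Theta

/-! ### The even part of the generating function of `v₀` -/

section Bilateral

open PowerSeries

theorem evalNegHom_expand {p : ℕ} (hp : p ≠ 0) (h2 : Even p) (f : ℚ⟦X⟧) :
    evalNegHom (expand p hp f) = expand p hp f := by
  ext n
  rw [evalNegHom, coeff_rescale, coeff_expand]
  split_ifs with h
  · rw [(h2.trans_dvd h).neg_one_pow, one_mul]
  · rw [mul_zero]

theorem phiNeg_sq : phiNeg ^ 2 = phi2 ^ 2 - 4 * X * psi4 ^ 2 := by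
  have h := congrArg evalNegHom phi_sq
  simp only [map_add, map_mul, map_pow, evalNegHom_X, map_ofNat] at h
  rw [← phiNeg, phi2, psi4, evalNegHom_expand _ (by decide), evalNegHom_expand _ (by decide),
    ← phi2, ← psi4] at h
  rw [h]
  ring

theorem expand_two_phi2 : expand 2 two_ne_zero phi2 = expand 4 (by norm_num) phi :=
  (expand_mul 2 two_ne_zero 2 two_ne_zero phi).symm

theorem expand_two_psi4 : expand 2 two_ne_zero psi4 = expand 8 (by norm_num) psi :=
  (expand_mul 2 two_ne_zero 4 four_ne_zero psi).symm

theorem phiNeg_eq : phiNeg = expand 2 two_ne_zero phi2 - 2 * X * expand 2 two_ne_zero psi4 := by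
  have h' := congrArg evalNegHom phi_eq
  simp only [map_add, map_mul, evalNegHom_X, map_ofNat] at h'
  rw [evalNegHom_expand _ (by decide), evalNegHom_expand _ (by decide), ← phiNeg] at h'
  rw [h', expand_two_phi2, expand_two_psi4]
  ring

/-- `φ(q) φ(-q) = φ(-q²)²`. -/
theorem phi_mul_phiNeg : phi * phiNeg = expand 2 two_ne_zero phiNeg ^ 2 := by
  have h := congrArg (expand 2 two_ne_zero) phiNeg_sq
  simp only [map_sub, map_mul, map_pow, expand_X, map_ofNat] at h
  rw [h, phiNeg_eq, expand_two_phi2, expand_two_psi4]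
  linear_combination (expand 4 (by norm_num) phi - 2 * X * expand 8 (by norm_num) psi) * phi_eq

theorem evalNegHom_qPoch (n : ℕ) : evalNegHom (qPoch X (X ^ 2) n) = qPoch (-X) (X ^ 2) n := by
  simp [qPoch, map_prod]

theorem evalNegHom_qPoch_neg (n : ℕ) : evalNegHom (qPoch (-X) (X ^ 2) n) = qPoch X (X ^ 2) n := by
  simp [qPoch, map_prod, sub_eq_add_neg]

theorem qPoch_mul_v0Term (n : ℕ) :
    qPoch X (X ^ 2) n * v0Term n = X ^ n ^ 2 * qPoch (-X) (X ^ 2) n := by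
  rw [v0Term]
  linear_combination X ^ n ^ 2 * qPoch (-X) (X ^ 2) n * qPoch_mul_invOfUnit n

theorem v0Term_zero : v0Term 0 = 1 := by
  simpa [qPoch] using qPoch_mul_v0Term 0

theorem v0_zero : v0 0 = 1 := by
  simp [v0, v0Term_zero]

/-- The term with index `-n` of the bilateral series is `tₙ(-q)`. -/
theorem qPoch_neg_mul_evalNegHom_v0Term (n : ℕ) :
    qPoch (-X) (X ^ 2) n * evalNegHom (v0Term n) = (-1) ^ n * X ^ n ^ 2 * qPoch X (X ^ 2) n := by
  have h := congrArg evalNegHom (qPoch_mul_v0Term n)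
  rw [map_mul, map_mul, evalNegHom_qPoch, evalNegHom_qPoch_neg, map_pow, evalNegHom_X,
    neg_pow X] at h
  rw [h]
  congr 2
  obtain h | h := Nat.even_or_odd n
  · rw [h.neg_one_pow, (h.pow_of_ne_zero two_ne_zero).neg_one_pow]
  · rw [h.neg_one_pow, h.pow.neg_one_pow]

theorem eval_one_tripleProd_X (M : ℕ) :
    (tripleProd (X : ℤ⟦X⟧) 1 M).eval 1 = qPoch (-X) (X ^ 2) M ^ 2 := by
  rw [tripleProd, Polynomial.eval_prod, qPoch, ← Finset.prod_pow]
  refine Finset.prod_congr rfl fun j _ => ?_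
  simp [-map_pow]
  ring

theorem eval_neg_one_tripleProd_X (M : ℕ) :
    (tripleProd (X : ℤ⟦X⟧) 1 M).eval (-1) = (-1) ^ M * qPoch X (X ^ 2) M ^ 2 := by
  rw [tripleProd, Polynomial.eval_prod, qPoch, ← Finset.prod_pow]
  nth_rw 2 [← Finset.card_range M]
  rw [← Finset.prod_const, ← Finset.prod_mul_distrib]
  refine Finset.prod_congr rfl fun j _ => ?_
  simp [-map_pow]
  ring

theorem qPoch_mul_qPoch_neg (M : ℕ) : qPoch X (X ^ 2) M * qPoch (-X) (X ^ 2) M =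
    ∏ j ∈ Finset.range M, (1 - X ^ (4 * j + 2)) := by
  rw [qPoch, qPoch, ← Finset.prod_mul_distrib]
  refine Finset.prod_congr rfl fun j _ => ?_
  ring

/-- The partial sums of the bilateral series `∑_{n ∈ ℤ} tₙ(q)`, where `t₋ₙ(q) = tₙ(-q)`, are the
values of `bilatPoly` at `x = 1`, up to a product. The term with index `0` equals `1` and occurs
twice in the sum, hence the subtraction. -/
theorem prod_mul_sum_v0Term (M : ℕ) : (∏ j ∈ Finset.range M, (1 - X ^ (4 * j + 2))) *
    (∑ n ∈ Finset.range (M + 1), (v0Term n + evalNegHom (v0Term n)) - 1) =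
      (bilatPoly (X : ℤ⟦X⟧) M).eval 1 := by
  induction M with
  | zero =>
    simp [v0Term_zero, bilatPoly]
  | succ M ih =>
    have h1 := qPoch_mul_v0Term (M + 1)
    have h2 := qPoch_neg_mul_evalNegHom_v0Term (M + 1)
    have h3 := qPoch_mul_qPoch_neg (M + 1)
    rw [eval_one_bilatPoly_succ, ← ih, Finset.sum_range_succ _ (M + 1), eval_one_tripleProd_X,
      eval_neg_one_tripleProd_X]
    rw [Finset.prod_range_succ] at h3 ⊢
    linear_combination qPoch (-X) (X ^ 2) (M + 1) * h1 + qPoch X (X ^ 2) (M + 1) * h2 -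
      (v0Term (M + 1) + evalNegHom (v0Term (M + 1))) * h3

/-- The series `-1/2 + ∑_{n ≥ 0} v₀(2^k n) qⁿ`. Since `v₀(0) = 1`, its constant term is `1/2`. -/
def v0Series (k : ℕ) : ℚ⟦X⟧ :=
  mk fun n => (v0 (2 ^ k * n) : ℚ) - if n = 0 then 1 / 2 else 0

/-- The bilateral series is twice `v0Series 1` at `q²`: adding `tₙ(-q)` to `tₙ(q)` doubles the even
powers of `q` and cancels the odd ones. -/
theorem X_pow_dvd_v0Series_sub (M : ℕ) : (X : ℚ⟦X⟧) ^ M ∣ 2 * expand 2 two_ne_zero (v0Series 1) -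
    map (Int.castRingHom ℚ)
      (∑ n ∈ Finset.range (M + 1), (v0Term n + evalNegHom (v0Term n)) - 1) := by
  rw [X_pow_dvd_iff]
  intro N hN
  have h : ∑ n ∈ Finset.range (M + 1), coeff N (v0Term n) = v0 N := by
    rw [v0]
    refine (Finset.sum_subset (Finset.range_mono (by omega)) fun n _ hn => ?_).symm
    exact coeff_v0Term (by simpa using hn)
  rw [map_sub, coeff_map, map_sub, map_sum]
  simp only [map_add, evalNegHom, coeff_rescale]
  rw [Finset.sum_add_distrib, ← Finset.mul_sum, h, two_mul, map_add, coeff_expand, coeff_one]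
  split_ifs with h2 h0 h0
  · subst h0
    norm_num [v0Series]
    ring
  · obtain ⟨n, rfl⟩ := h2
    have hn : n ≠ 0 := by rintro rfl; exact h0 rfl
    simp [v0Series, hn]
  · exact absurd (h0 ▸ dvd_zero 2) h2
  · rw [(Nat.not_even_iff_odd.1 fun h => h2 h.two_dvd).neg_one_pow]
    simp

theorem X_pow_dvd_phi2_sub_sum (M : ℕ) : (X : ℚ⟦X⟧) ^ M ∣
    phi2 - ∑ k ∈ Finset.Icc (-M : ℤ) M, X ^ (2 * k.natAbs ^ 2) := by
  refine X_pow_dvd_sub_sum (hasSum_expand_X_pow hasSum_phi 2 (by norm_num)) M _ fun k hk => ?_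
  have hk : M ≤ k.natAbs := by
    rw [Finset.mem_Icc] at hk
    omega
  exact pow_dvd_pow _ (by nlinarith)

theorem X_pow_dvd_expand_phiNeg_sub_sum (M : ℕ) : (X : ℚ⟦X⟧) ^ M ∣ expand 2 two_ne_zero phiNeg -
    ∑ k ∈ Finset.Icc (-M : ℤ) M, (-1) ^ k.natAbs * X ^ (2 * k.natAbs ^ 2) := by
  have h := hasSum_expand hasSum_phiNeg 2 two_ne_zero
  simp only [map_mul, map_pow, map_neg, map_one, expand_X, ← pow_mul] at h
  refine X_pow_dvd_sub_sum h M _ fun k hk => ?_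
  have hk : M ≤ k.natAbs := by
    rw [Finset.mem_Icc] at hk
    omega
  exact (pow_dvd_pow _ (by nlinarith)).mul_left _

/-- `(q²; q⁴)_M F(q) ≡ (-q²; q⁴)_M φ(q²)` modulo `q^M`, where `F` is the bilateral series. -/
theorem X_pow_dvd_prod_mul_v0Series (M : ℕ) : (X : ℚ⟦X⟧) ^ M ∣
    (∏ j ∈ Finset.range M, (1 - X ^ (4 * j + 2))) * (2 * expand 2 two_ne_zero (v0Series 1)) -
      (∏ j ∈ Finset.range M, (1 + X ^ (4 * j + 2))) * phi2 := by
  have h1 := X_pow_dvd_v0Series_sub M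
  have h2 := X_pow_dvd_phi2_sub_sum M
  have h3 := pow_dvd_eval_bilatPoly (X_ne_zero (R := ℤ)) M
  rw [eval_neg_one_bilatPoly, ← two_mul, ← mul_sub, ← prod_mul_sum_v0Term] at h3
  have h3 := map_dvd (map (Int.castRingHom ℚ)) h3
  rw [map_mul (map _) 2, map_ofNat] at h3
  -- The factor `2` is divided out over `ℚ`.
  have h3 := h3.mul_left (C (1 / 2))
  have h4 : (C (1 / 2 : ℚ)) * 2 = 1 := by
    rw [← map_ofNat C 2, ← map_mul]
    norm_num
  rw [← mul_assoc, h4, one_mul] at h3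
  generalize ∑ n ∈ Finset.range (M + 1), (v0Term n + evalNegHom (v0Term n)) - 1 = S at h1 h3
  have e1 : map (Int.castRingHom ℚ) (∏ j ∈ Finset.range M, (1 - X ^ (4 * j + 2))) =
      ∏ j ∈ Finset.range M, (1 - X ^ (4 * j + 2)) := by simp [map_prod]
  have e2 : map (Int.castRingHom ℚ) (∏ j ∈ Finset.range M, (1 + X ^ (4 * j + 2))) =
      ∏ j ∈ Finset.range M, (1 + X ^ (4 * j + 2)) := by simp [map_prod]
  rw [map_sub, map_mul, map_mul, e1, e2, map_sum, map_pow, map_X] at h3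
  simp only [map_pow, map_X] at h3
  convert ((h1.mul_left (∏ j ∈ Finset.range M, (1 - X ^ (4 * j + 2)))).add h3).add
    (h2.mul_left (-∏ j ∈ Finset.range M, (1 + X ^ (4 * j + 2)))) using 1
  ring

/-- `(-q²; q⁴)_M² φ(-q²) ≡ (q²; q⁴)_M² φ(q²)` modulo `q^M`. -/
theorem X_pow_dvd_prod_sq_mul_phiNeg (M : ℕ) : (X : ℚ⟦X⟧) ^ M ∣
    (∏ j ∈ Finset.range M, (1 + X ^ (4 * j + 2))) ^ 2 * expand 2 two_ne_zero phiNeg -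
      (∏ j ∈ Finset.range M, (1 - X ^ (4 * j + 2))) ^ 2 * phi2 := by
  have hX : (X : ℚ⟦X⟧) ^ M ∣ (X ^ 2) ^ M := by
    rw [← pow_mul]
    exact pow_dvd_pow _ (by omega)
  have hX0 : (X : ℚ⟦X⟧) ^ 2 ≠ 0 := pow_ne_zero 2 X_ne_zero
  have h1 := hX.trans (pow_dvd_eval_one_tripleProd hX0 M)
  have h2 := hX.trans (pow_dvd_eval_neg_one_tripleProd hX0 M)
  have h3 := X_pow_dvd_phi2_sub_sum M
  have h4 := X_pow_dvd_expand_phiNeg_sub_sum M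
  have e1 : (tripleProd ((X : ℚ⟦X⟧) ^ 2) 1 M).eval 1 =
      (∏ j ∈ Finset.range M, (1 + X ^ (4 * j + 2))) ^ 2 := by
    rw [tripleProd, Polynomial.eval_prod, ← Finset.prod_pow]
    refine Finset.prod_congr rfl fun j _ => ?_
    simp [-map_pow]
    ring
  have e2 : (-1) ^ M * (tripleProd ((X : ℚ⟦X⟧) ^ 2) 1 M).eval (-1) =
      (∏ j ∈ Finset.range M, (1 - X ^ (4 * j + 2))) ^ 2 := by
    rw [tripleProd, Polynomial.eval_prod, ← Finset.prod_pow]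
    nth_rw 1 [← Finset.card_range M]
    rw [← Finset.prod_const, ← Finset.prod_mul_distrib]
    refine Finset.prod_congr rfl fun j _ => ?_
    simp [-map_pow]
    ring
  rw [e1] at h1
  rw [e2] at h2
  simp only [← pow_mul] at h1 h2
  generalize (tripleProd ((X : ℚ⟦X⟧) ^ 2) 1 M).coeff M = c at h1 h2
  convert (((h1.mul_right (expand 2 two_ne_zero phiNeg)).add (h2.mul_right (-phi2))).add
    (h4.mul_left (c * phi2))).add (h3.mul_left (-c * expand 2 two_ne_zero phiNeg)) using 1
  ring

theorem eq_zero_of_forall_X_pow_dvd {f : ℚ⟦X⟧} (h : ∀ M : ℕ, X ^ M ∣ f) : f = 0 := by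
  ext n
  exact X_pow_dvd_iff.1 (h (n + 1)) n (by omega)

/-- `F(q)² φ(-q²) = φ(q²)³` with `q²` replaced by `q`, where `F` is the bilateral series: the
products in the two preceding congruences are eliminated. -/
theorem v0Series_one_sq_mul : (2 * v0Series 1) ^ 2 * phiNeg = phi ^ 3 := by
  -- The congruences are stated for `q²`, and `q ↦ q²` is injective on power series.
  have hinj : Function.Injective (expand (R := ℚ) 2 two_ne_zero) := fun f g hfg => by
    ext n
    rw [← coeff_expand_mul 2 two_ne_zero f, hfg, coeff_expand_mul]
  apply hinj
  rw [← sub_eq_zero]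
  refine eq_zero_of_forall_X_pow_dvd fun M => ?_
  have h1 := X_pow_dvd_prod_mul_v0Series M
  have h2 := X_pow_dvd_prod_sq_mul_phiNeg M
  simp only [map_mul, map_pow, map_ofNat]
  rw [← phi2]
  have hu : IsUnit (∏ j ∈ Finset.range M, (1 - X ^ (4 * j + 2)) : ℚ⟦X⟧) := by
    rw [isUnit_iff_constantCoeff, map_prod]
    simp
  refine (hu.pow 2).dvd_mul_left.1 ?_
  generalize (∏ j ∈ Finset.range M, (1 - X ^ (4 * j + 2)) : ℚ⟦X⟧) = d at h1 h2
  generalize (∏ j ∈ Finset.range M, (1 + X ^ (4 * j + 2)) : ℚ⟦X⟧) = c at h1 h2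
  set F := 2 * expand 2 two_ne_zero (v0Series 1)
  convert (h1.mul_right ((d * F + c * phi2) * expand 2 two_ne_zero phiNeg)).add
    (h2.mul_right (phi2 ^ 2)) using 1
  ring

theorem constantCoeff_phi : constantCoeff phi = 1 := by
  rw [← constantCoeff_phiNeg, phiNeg, ← coeff_zero_eq_constantCoeff_apply,
    ← coeff_zero_eq_constantCoeff_apply, evalNegHom, coeff_rescale]
  simp

/-- `-1 + 2 ∑ v₀(2n) qⁿ = φ(q)² / φ(-q²)`. -/
theorem v0Series_one_mul_phiNeg : 2 * v0Series 1 * expand 2 two_ne_zero phiNeg = phi ^ 2 := by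
  have h : (2 * v0Series 1 * expand 2 two_ne_zero phiNeg) ^ 2 = (phi ^ 2) ^ 2 := by
    linear_combination phi * v0Series_one_sq_mul - (2 * v0Series 1) ^ 2 * phi_mul_phiNeg
  obtain h | h := sq_eq_sq_iff_eq_or_eq_neg.1 h
  · exact h
  · -- The constant terms are `1` and `-1`, so this sign is impossible.
    have h0 := congrArg constantCoeff h
    have hv : constantCoeff (v0Series 1) = 1 / 2 := by
      rw [← coeff_zero_eq_constantCoeff_apply, v0Series, coeff_mk]
      norm_num [v0_zero]
    rw [map_mul, map_mul, hv, constantCoeff_expand, constantCoeff_phiNeg, map_neg, map_pow,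
      constantCoeff_phi, map_ofNat] at h0
    norm_num at h0

end Bilateral

/-! ### Matrices given by a two-term recurrence -/

section Lucas

/-- The common shape of the matrices `(m_{i,j})`, `(n_{i,j})`, `(p_{i,j})`, for the parameters
`(g, ε) = (1, -1), (2, 1), (4, 1)`. The polynomials `L_k(u) = ∑_j G_{k,j} u^j` satisfy
`L_k = u (2g L_{k-1} + ε L_{k-2})` for `k ≥ 3`, so they are Lucas polynomials up to normalization.
Row `0` and column `0`, which the matrices of the theorem do not have, are required to vanish. -/
structure IsLucasMatrix (g ε : ℤ) (G : ℕ → ℕ → ℤ) : Prop where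
  one_one : G 1 1 = g
  two_one : G 2 1 = ε
  two_two : G 2 2 = 2 * g ^ 2
  succ_succ : ∀ i j, G (i + 3) (j + 2) = 2 * g * G (i + 2) (j + 1) + ε * G (i + 1) (j + 1)
  zero_right : ∀ i, G i 0 = 0
  add_three_one : ∀ i, G (i + 3) 1 = 0
  eq_zero_of_lt : ∀ i j, i < j → G i j = 0

theorem isLucasMatrix_mMat : IsLucasMatrix 1 (-1) mMat where
  one_one := rfl
  two_one := rfl
  two_two := rfl
  succ_succ i j := by rw [mMat]; ring
  zero_right i := by rcases i with _ | _ | _ | i <;> rfl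
  add_three_one i := rfl
  eq_zero_of_lt := mMat_eq_zero

theorem isLucasMatrix_nMat : IsLucasMatrix 2 1 nMat where
  one_one := rfl
  two_one := rfl
  two_two := rfl
  succ_succ i j := by rw [nMat]; ring
  zero_right i := by rcases i with _ | _ | _ | i <;> rfl
  add_three_one i := rfl
  eq_zero_of_lt := nMat_eq_zero

theorem isLucasMatrix_pMat : IsLucasMatrix 4 1 pMat where
  one_one := rfl
  two_one := rfl
  two_two := rfl
  succ_succ i j := by rw [pMat]; ring
  zero_right i := by rcases i with _ | _ | _ | i <;> rfl
  add_three_one i := rfl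
  eq_zero_of_lt := pMat_eq_zero

variable {R : Type*} [CommRing R] {g ε : ℤ} {G : ℕ → ℕ → ℤ}

theorem IsLucasMatrix.eq_zero_of_two_mul_lt (hG : IsLucasMatrix g ε G) (i j : ℕ) (h : 2 * j < i) :
    G i j = 0 := by
  induction j generalizing i with
  | zero => exact hG.zero_right i
  | succ j ih =>
    obtain ⟨i, rfl⟩ := Nat.exists_eq_add_of_le' (show 3 ≤ i by omega)
    rcases j with _ | j
    · exact hG.add_three_one i
    · rw [hG.succ_succ, ih _ (by omega), ih _ (by omega)]
      ring

/-- The recurrence of the row polynomials `∑_j G_{k,j} u^j`. -/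
theorem IsLucasMatrix.sum_add_two (hG : IsLucasMatrix g ε G) (u : R) (k N : ℕ) (hN : k + 3 < N) :
    ∑ j ∈ Finset.range N, (G (k + 3) j : R) * u ^ j =
      u * (2 * g * ∑ j ∈ Finset.range N, (G (k + 2) j : R) * u ^ j +
        ε * ∑ j ∈ Finset.range N, (G (k + 1) j : R) * u ^ j) := by
  obtain ⟨N, rfl⟩ := Nat.exists_eq_add_of_le' (show 2 ≤ N by omega)
  rw [Finset.sum_range_succ', Finset.sum_range_succ', Finset.sum_range_succ' _ (N + 1),
    Finset.sum_range_succ' _ (N + 1), Finset.sum_range_succ _ N, Finset.sum_range_succ _ N]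
  simp only [hG.zero_right, zero_add, hG.add_three_one, add_assoc, Nat.reduceAdd]
  simp only [hG.succ_succ, hG.eq_zero_of_lt (k + 2) (N + 1) (by omega),
    hG.eq_zero_of_lt (k + 1) (N + 1) (by omega)]
  simp only [Finset.mul_sum, mul_add, ← Finset.sum_add_distrib, Int.cast_zero, zero_mul, add_zero]
  refine Finset.sum_congr rfl fun j _ => ?_
  push_cast
  ring

/-- The rows of the matrix express power sums: if `x + y = 2gs`, `xy = -εt` and `u = s² / t`, then
`x^k + y^k = 2 (t / s)^k ∑_j G_{k,j} u^j`. Both sides satisfy the same two-term recurrence. -/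
theorem IsLucasMatrix.pow_mul_add (hG : IsLucasMatrix g ε G) {x y s t u : R}
    (hs : x + y = 2 * g * s) (ht : x * y = -ε * t) (hu : t * u = s ^ 2) (k N : ℕ) (hk : k + 1 < N) :
    s ^ (k + 1) * (x ^ (k + 1) + y ^ (k + 1)) =
      2 * t ^ (k + 1) * ∑ j ∈ Finset.range N, (G (k + 1) j : R) * u ^ j := by
  have hsmall (i : ℕ) (hi : i + 1 < N) : ∑ j ∈ Finset.range N, (G i j : R) * u ^ j =
      ∑ j ∈ Finset.range (i + 1), (G i j : R) * u ^ j := by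
    refine (Finset.sum_subset (Finset.range_mono hi.le) fun j _ hj => ?_).symm
    rw [hG.eq_zero_of_lt i j (by simpa using hj), Int.cast_zero, zero_mul]
  induction k using Nat.twoStepInduction with
  | zero =>
    obtain rfl | hN := Nat.eq_or_lt_of_le (show 2 ≤ N by omega)
    · simp [Finset.sum_range_succ, hG.zero_right, hG.one_one]
      linear_combination s * hs - 2 * g * hu
    · rw [hsmall 1 hN]
      simp [Finset.sum_range_succ, hG.zero_right, hG.one_one]
      linear_combination s * hs - 2 * g * hu
  | one =>
    have : ∑ j ∈ Finset.range N, (G 2 j : R) * u ^ j = ε * u + 2 * g ^ 2 * u ^ 2 := by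
      rw [← Finset.sum_subset (Finset.range_mono (show 3 ≤ N by omega)) fun j _ hj => by
        rw [hG.eq_zero_of_lt 2 j (by simp at hj; omega), Int.cast_zero, zero_mul]]
      simp [Finset.sum_range_succ, hG.zero_right, hG.two_one, hG.two_two]
    rw [this]
    linear_combination s ^ 2 * (x + y + 2 * g * s) * hs - 2 * s ^ 2 * ht -
      (2 * ε * t + 4 * g ^ 2 * (t * u + s ^ 2)) * hu
  | more k ih1 ih2 =>
    have ih1 := ih1 (by omega)
    have ih2 := ih2 (by omega)
    rw [hG.sum_add_two u k N (by omega)]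
    simp only [add_assoc, Nat.reduceAdd] at ih1 ih2 ⊢
    set S1 := ∑ j ∈ Finset.range N, (G (k + 1) j : R) * u ^ j
    set S2 := ∑ j ∈ Finset.range N, (G (k + 2) j : R) * u ^ j
    linear_combination 2 * g * s ^ 2 * ih2 + ε * t * s ^ 2 * ih1 +
      s ^ (k + 3) * (x ^ (k + 2) + y ^ (k + 2)) * hs -
      s ^ (k + 3) * (x ^ (k + 1) + y ^ (k + 1)) * ht -
      (4 * g * t ^ (k + 2) * S2 + 2 * ε * t ^ (k + 2) * S1) * hu

/-- `IsLucasMatrix.pow_mul_add` for an odd exponent `2b + 1`, with `κ = 1 / θ`. The entries of row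
`2b + 1` in the columns up to `b` vanish, so the powers of `s` cancel. -/
theorem IsLucasMatrix.odd_pow_add [IsDomain R] (hG : IsLucasMatrix g ε G) {x y s θ κ : R}
    (hs : x + y = 2 * g * s) (ht : x * y = -ε * θ ^ 2) (hθ : θ * κ = 1) (hs0 : s ≠ 0)
    (b N : ℕ) (hN : b < N) :
    x ^ (2 * b + 1) + y ^ (2 * b + 1) = 2 * θ ^ (2 * b) *
      ∑ j ∈ Finset.range N, (G (2 * b + 1) (b + j + 1) : R) * (s ^ (2 * j + 1) * κ ^ (2 * j)) := by
  apply mul_left_cancel₀ (pow_ne_zero (2 * b + 1) hs0)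
  have hu : θ ^ 2 * (s * κ) ^ 2 = s ^ 2 := by
    linear_combination s ^ 2 * (θ * κ + 1) * hθ
  rw [hG.pow_mul_add hs ht hu (2 * b) (b + 1 + N) (by omega), Finset.sum_range_add,
    Finset.sum_eq_zero (s := Finset.range (b + 1)), zero_add, Finset.mul_sum, Finset.mul_sum,
    Finset.mul_sum]
  · refine Finset.sum_congr rfl fun j _ => ?_
    have e : θ ^ (2 * b + 2) * κ ^ (2 * b + 2) = 1 := by rw [← mul_pow, hθ, one_pow]
    rw [show b + 1 + j = b + j + 1 by ring]
    linear_combination 2 * G (2 * b + 1) (b + j + 1) * θ ^ (2 * b) * s ^ (2 * b + 2 * j + 2) *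
      κ ^ (2 * j) * e
  · intro j hj
    rw [hG.eq_zero_of_two_mul_lt _ _ (by rw [Finset.mem_range] at hj; omega), Int.cast_zero,
      zero_mul]

end Lucas

/-! ### Bisection of theta quotients -/

section Dissection

open PowerSeries

/-- The even part `∑ aₙ qⁿ ↦ ∑ a₂ₙ qⁿ`. -/
def bisect : ℚ⟦X⟧ →ₗ[ℚ] ℚ⟦X⟧ where
  toFun f := mk fun n => coeff (2 * n) f
  map_add' f g := by ext; simp
  map_smul' c f := by ext; simp

/-- The odd part `∑ aₙ qⁿ ↦ ∑ a₂ₙ₊₁ qⁿ`. -/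
def bisectOdd : ℚ⟦X⟧ →ₗ[ℚ] ℚ⟦X⟧ where
  toFun f := mk fun n => coeff (2 * n + 1) f
  map_add' f g := by ext; simp
  map_smul' c f := by ext; simp

theorem bisect_eq {f g : ℚ⟦X⟧} (h : f + evalNegHom f = 2 * expand 2 two_ne_zero g) :
    bisect f = g := by
  ext n
  have h := congrArg (coeff (2 * n)) h
  rw [map_add, evalNegHom, coeff_rescale, (even_two_mul n).neg_one_pow,
    two_mul (expand _ _ g), map_add, coeff_expand_mul] at h
  change coeff n (mk fun n => coeff (2 * n) f) = _
  rw [coeff_mk]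
  linarith

theorem bisectOdd_eq {f g : ℚ⟦X⟧} (h : f - evalNegHom f = 2 * X * expand 2 two_ne_zero g) :
    bisectOdd f = g := by
  ext n
  have h := congrArg (coeff (2 * n + 1)) h
  rw [map_sub, evalNegHom, coeff_rescale, (odd_two_mul_add_one n).neg_one_pow, mul_right_comm,
    coeff_succ_mul_X, two_mul (expand _ _ g), map_add, coeff_expand_mul] at h
  change coeff n (mk fun n => coeff (2 * n + 1) f) = _
  rw [coeff_mk]
  linarith

theorem bisect_v0Series (k : ℕ) : bisect (v0Series k) = v0Series (k + 1) := by
  ext n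
  change coeff n (mk fun n => coeff (2 * n) (v0Series k)) = _
  simp [v0Series, pow_succ, mul_assoc]

theorem evalNegHom_phi : evalNegHom phi = phiNeg := rfl

theorem evalNegHom_phi2 : evalNegHom phi2 = phi2 := evalNegHom_expand _ (by decide) _

theorem evalNegHom_psi4 : evalNegHom psi4 = psi4 := evalNegHom_expand _ (by decide) _

theorem expand_two_phi : expand 2 two_ne_zero phi = phi2 := rfl

theorem expand_two_psi2 : expand 2 two_ne_zero psi2 = psi4 :=
  (expand_mul 2 two_ne_zero 2 two_ne_zero psi).symm

theorem phi_add_phiNeg : phi + phiNeg = 2 * expand 2 two_ne_zero phi2 := by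
  rw [phiNeg_eq, expand_two_phi2, expand_two_psi4]
  linear_combination phi_eq

theorem phi_sub_phiNeg : phi - phiNeg = 4 * (X * expand 2 two_ne_zero psi4) := by
  rw [phiNeg_eq, expand_two_phi2, expand_two_psi4]
  linear_combination phi_eq

theorem phiNeg_mul_inv : phiNeg * phiNeg⁻¹ = 1 :=
  PowerSeries.mul_inv_cancel _ (by rw [constantCoeff_phiNeg]; exact one_ne_zero)

theorem phiNeg_pow_inv (n : ℕ) : (phiNeg ^ n)⁻¹ = phiNeg⁻¹ ^ n := by
  rw [eq_comm, PowerSeries.eq_inv_iff_mul_eq_one, ← mul_pow, mul_comm, phiNeg_mul_inv, one_pow]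
  rw [map_pow, constantCoeff_phiNeg, one_pow]
  exact one_ne_zero

theorem expand_phiNeg_mul_inv :
    expand 2 two_ne_zero phiNeg * expand 2 two_ne_zero phiNeg⁻¹ = 1 := by
  rw [← map_mul, phiNeg_mul_inv, map_one]

/-- `1 / φ(-q) = φ(q) / φ(-q²)²`: the denominators become even functions of `q`. -/
theorem phiNeg_inv_eq : phiNeg⁻¹ = phi * expand 2 two_ne_zero phiNeg⁻¹ ^ 2 := by
  have h1 := phiNeg_mul_inv
  have h2 := expand_phiNeg_mul_inv
  linear_combination phi * expand 2 two_ne_zero phiNeg⁻¹ ^ 2 * h1 -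
    phiNeg⁻¹ * expand 2 two_ne_zero phiNeg⁻¹ ^ 2 * phi_mul_phiNeg -
    phiNeg⁻¹ * (expand 2 two_ne_zero phiNeg * expand 2 two_ne_zero phiNeg⁻¹ + 1) * h2

theorem evalNegHom_phiNeg_inv :
    evalNegHom phiNeg⁻¹ = phiNeg * expand 2 two_ne_zero phiNeg⁻¹ ^ 2 := by
  conv_lhs => rw [phiNeg_inv_eq]
  rw [map_mul, map_pow, evalNegHom_phi, evalNegHom_expand _ (by decide)]

theorem phi_sq_add_phiNeg_sq : phi ^ 2 + phiNeg ^ 2 = 2 * phi2 ^ 2 := by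
  linear_combination phi_sq + phiNeg_sq

theorem phi_sq_sub_phiNeg_sq : phi ^ 2 - phiNeg ^ 2 = 8 * (X * psi4 ^ 2) := by
  linear_combination phi_sq - phiNeg_sq

theorem psi_ne_zero : psi ≠ 0 := fun h => by
  have h0 := congrArg (coeff 0) h
  have hf : {k : ℕ | k * (k + 1) / 2 = 0}.Finite := by
    refine (Set.finite_Iic 1).subset fun k (hk : k * (k + 1) / 2 = 0) => ?_
    rw [Set.mem_Iic]
    by_contra hk1
    have : 2 * 2 ≤ k * (k + 1) := Nat.mul_le_mul (by omega) (by omega)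
    omega
  rw [psi, coeff_mk, map_zero, Nat.cast_eq_zero, Set.ncard_eq_zero hf] at h0
  exact Set.eq_empty_iff_forall_notMem.1 h0 0 rfl

theorem phi_ne_zero : phi ≠ 0 := fun h => by
  have h0 := constantCoeff_phi
  rw [h, map_zero] at h0
  exact zero_ne_one h0

theorem expand_ne_zero {p : ℕ} (hp : p ≠ 0) {f : ℚ⟦X⟧} (hf : f ≠ 0) : expand p hp f ≠ 0 :=
  fun h => hf (by
    ext n
    rw [← coeff_expand_mul p hp f, h, map_zero, map_zero])

/-- `φ(q)^{4j+1} / φ(-q)^{4j}`. -/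
def phiQuot (j : ℕ) : ℚ⟦X⟧ := phi ^ (4 * j + 1) * phiNeg⁻¹ ^ (4 * j)

/-- `φ(q²)^{2j+1} / φ(-q)^{2j}`. -/
def phi2Quot (j : ℕ) : ℚ⟦X⟧ := phi2 ^ (2 * j + 1) * phiNeg⁻¹ ^ (2 * j)

/-- `q^j ψ(q⁴)^{2j+1} / φ(-q)^{2j}`. -/
def psi4Quot (j : ℕ) : ℚ⟦X⟧ := X ^ j * psi4 ^ (2 * j + 1) * phiNeg⁻¹ ^ (2 * j)

/-- `q^j ψ(q²)^{4j+1} / φ(-q)^{4j}`. -/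
def psi2Quot (j : ℕ) : ℚ⟦X⟧ := X ^ j * psi2 ^ (4 * j + 1) * phiNeg⁻¹ ^ (4 * j)

theorem intCast_smul (m : ℤ) (f : ℚ⟦X⟧) : (m : ℚ) • f = m * f := by
  rw [Int.cast_smul_eq_zsmul, zsmul_eq_mul]

/-- The even part of `φ(q)^{4i+1} / φ(-q)^{4i} = φ(q)^{8i+1} / φ(-q²)^{8i}` is governed by the power
sums of `φ(q)` and `φ(-q)`, whose sum is `2 φ(q⁴)` and whose product is `φ(-q²)²`. -/
theorem bisect_phiQuot (i N : ℕ) (hN : 4 * i < N) :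
    bisect (phiQuot i) = ∑ j ∈ Finset.range N, (matA (i + 1) (j + 1) : ℚ) • phi2Quot j := by
  apply bisect_eq
  have h := isLucasMatrix_mMat.odd_pow_add (x := phi) (y := phiNeg)
    (s := expand 2 two_ne_zero phi2) (by rw [phi_add_phiNeg]; simp)
    (by rw [phi_mul_phiNeg]; simp) expand_phiNeg_mul_inv
    (expand_ne_zero _ (expand_ne_zero _ phi_ne_zero)) (4 * i) N hN
  have e : expand 2 two_ne_zero phiNeg ^ (8 * i) * expand 2 two_ne_zero phiNeg⁻¹ ^ (8 * i) = 1 := by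
    rw [← mul_pow, expand_phiNeg_mul_inv, one_pow]
  have hA (j : ℕ) : matA (i + 1) (j + 1) = mMat (2 * (4 * i) + 1) (4 * i + j + 1) := by
    rw [matA, aCoef]
    congr 1
    omega
  -- The sum is made opaque: from here on only ring identities in `S` are needed.
  obtain ⟨S, hS⟩ : ∃ S, S = ∑ j ∈ Finset.range N, (mMat (2 * (4 * i) + 1) (4 * i + j + 1) : ℚ⟦X⟧) *
      (expand 2 two_ne_zero phi2 ^ (2 * j + 1) * expand 2 two_ne_zero phiNeg⁻¹ ^ (2 * j)) :=
    ⟨_, rfl⟩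
  rw [← hS] at h
  simp only [hA, intCast_smul, map_sum, map_mul, map_intCast, phi2Quot, map_pow, ← hS]
  have hι := phiNeg_inv_eq
  rw [phiQuot, map_mul, map_pow, map_pow, evalNegHom_phi, evalNegHom_phiNeg_inv]
  generalize expand 2 two_ne_zero phiNeg⁻¹ = κ at h e hι ⊢
  rw [hι]
  linear_combination κ ^ (8 * i) * h + 2 * S * e

/-- The odd part of `φ(q)^{4i+1} / φ(-q)^{4i} = φ(q)^{8i+1} / φ(-q²)^{8i}` is governed by the power
sums of `φ(q)` and `-φ(-q)`, whose sum is `4q ψ(q⁸)` and whose product is `-φ(-q²)²`. -/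
theorem bisectOdd_phiQuot (i N : ℕ) (hN : 4 * i < N) :
    bisectOdd (phiQuot i) = ∑ j ∈ Finset.range N, (matC (i + 1) (j + 1) : ℚ) • psi4Quot j := by
  apply bisectOdd_eq
  have h := isLucasMatrix_nMat.odd_pow_add (x := phi) (y := -phiNeg)
    (s := X * expand 2 two_ne_zero psi4)
    (by rw [← sub_eq_add_neg, phi_sub_phiNeg]; push_cast; ring)
    (by rw [mul_neg, phi_mul_phiNeg]; simp) expand_phiNeg_mul_inv
    (mul_ne_zero X_ne_zero (expand_ne_zero _ (expand_ne_zero _ psi_ne_zero))) (4 * i) N hN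
  rw [(odd_two_mul_add_one _).neg_pow] at h
  have e : expand 2 two_ne_zero phiNeg ^ (8 * i) * expand 2 two_ne_zero phiNeg⁻¹ ^ (8 * i) = 1 := by
    rw [← mul_pow, expand_phiNeg_mul_inv, one_pow]
  have hC (j : ℕ) : matC (i + 1) (j + 1) = nMat (2 * (4 * i) + 1) (4 * i + j + 1) := by
    rw [matC, cCoef]
    congr 1
    omega
  obtain ⟨S, hS⟩ : ∃ S, S = ∑ j ∈ Finset.range N, (nMat (2 * (4 * i) + 1) (4 * i + j + 1) : ℚ⟦X⟧) *
      ((X * expand 2 two_ne_zero psi4) ^ (2 * j + 1) *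
        expand 2 two_ne_zero phiNeg⁻¹ ^ (2 * j)) := ⟨_, rfl⟩
  have hS' : X * expand 2 two_ne_zero
      (∑ j ∈ Finset.range N, (matC (i + 1) (j + 1) : ℚ) • psi4Quot j) = S := by
    rw [map_sum, Finset.mul_sum, hS]
    refine Finset.sum_congr rfl fun j _ => ?_
    simp only [hC, intCast_smul, map_mul, map_intCast, psi4Quot, map_pow, expand_X]
    ring
  rw [← hS] at h
  rw [mul_assoc, hS']
  have hι := phiNeg_inv_eq
  rw [phiQuot, map_mul, map_pow, map_pow, evalNegHom_phi, evalNegHom_phiNeg_inv]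
  generalize expand 2 two_ne_zero phiNeg⁻¹ = κ at h e hι ⊢
  rw [hι]
  linear_combination κ ^ (8 * i) * h + 2 * S * e

/-- The even part of `φ(q²)^{2i+1} / φ(-q)^{2i}` is governed by the power sums of `φ(q)²` and
`φ(-q)²`, whose sum is `2 φ(q²)²` and whose product is `φ(-q²)⁴`. -/
theorem bisect_phi2Quot (i N : ℕ) (hN : i < N) :
    bisect (phi2Quot i) = ∑ j ∈ Finset.range N, (matB (i + 1) (j + 1) : ℚ) • phiQuot j := by
  apply bisect_eq
  have hθ := expand_phiNeg_mul_inv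
  rcases i with _ | k
  · rw [← Finset.sum_subset (Finset.range_mono hN) fun j _ hj => ?_]
    · simp [phi2Quot, phiQuot, matB, evalNegHom_phi2, expand_two_phi]
      ring
    · obtain ⟨j, rfl⟩ := Nat.exists_eq_succ_of_ne_zero (n := j) (by simpa using hj)
      simp [matB]
  · have h := isLucasMatrix_mMat.pow_mul_add (x := phi ^ 2) (y := phiNeg ^ 2)
      (s := phi2 ^ 2) (t := expand 2 two_ne_zero phiNeg ^ 4)
      (u := phi2 ^ 4 * expand 2 two_ne_zero phiNeg⁻¹ ^ 4)
      (by rw [phi_sq_add_phiNeg_sq]; push_cast; ring)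
      (by rw [← mul_pow, phi_mul_phiNeg]; push_cast; ring)
      (by
        rw [mul_left_comm, ← mul_pow, hθ]
        ring) k N hN
    have e : expand 2 two_ne_zero phiNeg ^ (4 * (k + 1)) *
        expand 2 two_ne_zero phiNeg⁻¹ ^ (4 * (k + 1)) = 1 := by
      rw [← mul_pow, hθ, one_pow]
    have hB (j : ℕ) : matB (k + 1 + 1) (j + 1) = mMat (k + 1) j := by
      rcases j with _ | j
      · exact (isLucasMatrix_mMat.zero_right _).symm
      · rfl
    obtain ⟨S, hS⟩ : ∃ S, S = ∑ j ∈ Finset.range N, (mMat (k + 1) j : ℚ⟦X⟧) *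
      (phi2 ^ 4 * expand 2 two_ne_zero phiNeg⁻¹ ^ 4) ^ j := ⟨_, rfl⟩
    have hS' : expand 2 two_ne_zero
        (∑ j ∈ Finset.range N, (matB (k + 1 + 1) (j + 1) : ℚ) • phiQuot j) = phi2 * S := by
      rw [map_sum, hS, Finset.mul_sum]
      refine Finset.sum_congr rfl fun j _ => ?_
      simp only [hB, intCast_smul, map_mul, map_intCast, phiQuot, map_pow, expand_two_phi]
      ring
    rw [← hS] at h
    have hι := phiNeg_inv_eq
    rw [hS', phi2Quot, map_mul, map_pow, map_pow, evalNegHom_phi2, evalNegHom_phiNeg_inv]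
    generalize expand 2 two_ne_zero phiNeg⁻¹ = κ at h e hι ⊢
    rw [hι]
    linear_combination phi2 * κ ^ (4 * (k + 1)) * h + 2 * phi2 * S * e

/-- The even part of `q^i ψ(q⁴)^{2i+1} / φ(-q)^{2i}` is governed by the power sums of `q φ(q)²` and
`-q φ(-q)²`, whose sum is `8 q² ψ(q⁴)²` and whose product is `-q² φ(-q²)⁴`. -/
theorem bisect_psi4Quot (i N : ℕ) (hN : i < N) :
    bisect (psi4Quot i) = ∑ j ∈ Finset.range N, (matD (i + 1) (j + 1) : ℚ) • psi2Quot j := by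
  apply bisect_eq
  have hθ := expand_phiNeg_mul_inv
  rcases i with _ | k
  · rw [← Finset.sum_subset (Finset.range_mono hN) fun j _ hj => ?_]
    · simp [psi4Quot, psi2Quot, matD, evalNegHom_psi4, expand_two_psi2]
      ring
    · obtain ⟨j, rfl⟩ := Nat.exists_eq_succ_of_ne_zero (n := j) (by simpa using hj)
      simp [matD]
  · have h := isLucasMatrix_pMat.pow_mul_add (x := X * phi ^ 2) (y := -X * phiNeg ^ 2)
      (s := X ^ 2 * psi4 ^ 2) (t := X ^ 2 * expand 2 two_ne_zero phiNeg ^ 4)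
      (u := X ^ 2 * psi4 ^ 4 * expand 2 two_ne_zero phiNeg⁻¹ ^ 4)
      (by
        push_cast
        linear_combination X * phi_sq_sub_phiNeg_sq)
      (by
        have := congrArg (· ^ 2) phi_mul_phiNeg
        push_cast
        linear_combination -X ^ 2 * this)
      (by
        have := congrArg (· ^ 4) hθ
        linear_combination X ^ 4 * psi4 ^ 4 * this) k N hN
    have e : expand 2 two_ne_zero phiNeg ^ (4 * (k + 1)) *
        expand 2 two_ne_zero phiNeg⁻¹ ^ (4 * (k + 1)) = 1 := by
      rw [← mul_pow, hθ, one_pow]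
    have hD (j : ℕ) : matD (k + 1 + 1) (j + 1) = pMat (k + 1) j := by
      rcases j with _ | j
      · exact (isLucasMatrix_pMat.zero_right _).symm
      · rfl
    obtain ⟨S, hS⟩ : ∃ S, S = ∑ j ∈ Finset.range N, (pMat (k + 1) j : ℚ⟦X⟧) *
      (X ^ 2 * psi4 ^ 4 * expand 2 two_ne_zero phiNeg⁻¹ ^ 4) ^ j := ⟨_, rfl⟩
    have hS' : expand 2 two_ne_zero
        (∑ j ∈ Finset.range N, (matD (k + 1 + 1) (j + 1) : ℚ) • psi2Quot j) = psi4 * S := by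
      rw [map_sum, hS, Finset.mul_sum]
      refine Finset.sum_congr rfl fun j _ => ?_
      simp only [hD, intCast_smul, map_mul, map_intCast, psi2Quot, map_pow, expand_two_psi2,
        expand_X]
      ring
    rw [← hS] at h
    have hι := phiNeg_inv_eq
    rw [hS', psi4Quot, map_mul, map_mul, map_pow, map_pow, map_pow, evalNegHom_psi4,
      evalNegHom_X, evalNegHom_phiNeg_inv]
    generalize expand 2 two_ne_zero phiNeg⁻¹ = κ at h e hι ⊢
    rw [hι]
    -- The recurrence holds for `q φ(q)²` and `-q φ(-q)²`, so their powers and `t^{k+1}` carry extra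
    -- factors `q`, which balance after multiplication with `q^{2(k+1)}`.
    apply mul_left_cancel₀ (pow_ne_zero (2 * (k + 1)) (X_ne_zero (R := ℚ)))
    linear_combination psi4 * κ ^ (4 * (k + 1)) * h +
      2 * X ^ (2 * (k + 1)) * psi4 * S * e

/-- The case `α = 1` of the first identity, obtained from `φ(q)² / (2 φ(-q²))` by three
bisections. -/
theorem v0Series_four : v0Series 4 = (-3 / 2 : ℚ) • phiQuot 0 + (2 : ℚ) • phiQuot 1 := by
  have hθ := expand_phiNeg_mul_inv
  have hC : (2 : ℚ⟦X⟧) * C (1 / 2) = 1 := by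
    rw [← map_ofNat C 2, ← map_mul]
    norm_num
  have h1 : v0Series 1 = (1 / 2 : ℚ) • (phi ^ 2 * expand 2 two_ne_zero phiNeg⁻¹) := by
    rw [smul_eq_C_mul]
    linear_combination C (1 / 2) * expand 2 two_ne_zero phiNeg⁻¹ * v0Series_one_mul_phiNeg -
      v0Series 1 * hθ - v0Series 1 * expand 2 two_ne_zero phiNeg *
        expand 2 two_ne_zero phiNeg⁻¹ * hC
  have h2 : v0Series 2 = (1 / 2 : ℚ) • (phi ^ 2 * phiNeg⁻¹) := by
    rw [← bisect_v0Series, h1, map_smul]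
    congr 1
    apply bisect_eq
    rw [map_mul, map_mul, map_pow, map_pow, evalNegHom_phi, evalNegHom_expand _ even_two,
      expand_two_phi]
    linear_combination expand 2 two_ne_zero phiNeg⁻¹ * phi_sq_add_phiNeg_sq
  have h3 : v0Series 3 = (-3 / 2 : ℚ) • phi2Quot 0 + (2 : ℚ) • phi2Quot 1 := by
    have e : (-3 / 2 : ℚ) • phi2Quot 0 + (2 : ℚ) • phi2Quot 1 =
        (1 / 2 : ℚ) • ((4 : ℚ) • phi2Quot 1 - (3 : ℚ) • phi2Quot 0) := by
      module
    rw [← bisect_v0Series, h2, e, map_smul]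
    congr 1
    apply bisect_eq
    have hι := phiNeg_inv_eq
    have ha := phi_add_phiNeg
    have hm := phi_mul_phiNeg
    rw [map_mul, map_pow, evalNegHom_phi, evalNegHom_phiNeg_inv, phi2Quot, phi2Quot]
    simp only [smul_eq_C_mul, map_sub, map_mul, map_pow, map_ofNat]
    generalize expand 2 two_ne_zero phiNeg⁻¹ = κ at hθ hι ⊢
    rw [hι]
    generalize expand 2 two_ne_zero phiNeg = θ at hθ hm
    generalize expand 2 two_ne_zero phi2 = s at ha
    -- Up to the factor `κ²`, this is `x³ + y³ = (x + y)³ - 3xy(x + y)` for `x = φ(q)`, `y = φ(-q)`.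
    linear_combination κ ^ 2 * ((phi + phiNeg) ^ 2 + 2 * s * (phi + phiNeg) + 4 * s ^ 2) * ha -
      3 * κ ^ 2 * (phi + phiNeg) * hm - 3 * κ ^ 2 * θ ^ 2 * ha - 6 * s * (θ * κ + 1) * hθ
  rw [← bisect_v0Series, h3, map_add, map_smul, map_smul, bisect_phi2Quot 0 1 (by norm_num),
    bisect_phi2Quot 1 2 (by norm_num)]
  simp [Finset.sum_range_succ, matB, mMat]

theorem C_half_add_mk_v0 (k : ℕ) : C (1 / 2 : ℚ) +
    mk (fun n => if n = 0 then 0 else (v0 (2 ^ k * n) : ℚ)) = v0Series k := by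
  ext n
  rcases n with _ | n
  · norm_num [v0Series, v0_zero]
  · simp [v0Series]

/-- The combination `∑_{j ≥ 1} v_j F_{j-1}` of a family of series that is indexed from `0`, with
coefficients indexed from `1`. -/
def rowSum (v : ℕ → ℚ) (F : ℕ → ℚ⟦X⟧) : ℚ⟦X⟧ :=
  ∑ᶠ j ∈ Set.Ici 1, v j • F (j - 1)

theorem finsum_Ici_one_eq_sum_range {A : Type*} [AddCommMonoid A] (f : ℕ → A) (N : ℕ)
    (h : ∀ j, N < j → f j = 0) :
    ∑ᶠ j ∈ Set.Ici 1, f j = ∑ j ∈ Finset.range N, f (j + 1) := by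
  rw [← Finset.sum_image (s := Finset.range N) (g := (· + 1)) (f := f)
    (fun _ _ _ _ h => by simpa using h), ← finsum_mem_coe_finset]
  refine finsum_mem_inter_support_eq' _ _ _ fun j hj => ?_
  have hj : j ≤ N := by
    by_contra hN
    exact hj (h j (by omega))
  simp only [Set.mem_Ici, Finset.coe_image, Finset.coe_range, Set.mem_image, Set.mem_Iio]
  exact ⟨fun h => ⟨j - 1, by omega, by omega⟩, by rintro ⟨i, hi, rfl⟩; omega⟩

/-- If a linear map sends `F` to `G` through the matrix `M`, it sends the combination with
coefficient vector `u` to the one with coefficient vector `u M`. The band condition on `M` makes all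
sums finite. -/
theorem map_rowSum (L : ℚ⟦X⟧ →ₗ[ℚ] ℚ⟦X⟧) {u : ℕ → ℚ} {M : ℕ → ℕ → ℤ} {F G : ℕ → ℚ⟦X⟧}
    (hu : u.support.Finite) (hM : ∀ i j, 1 ≤ i → 4 * i < j → M i j = 0)
    (hL : ∀ i N, 4 * i < N → L (F i) = ∑ j ∈ Finset.range N, (M (i + 1) (j + 1) : ℚ) • G j) :
    L (rowSum u F) = rowSum (rowMul u M) G := by
  obtain ⟨N, hN⟩ := hu.bddAbove
  have hu0 (i : ℕ) (hi : N < i) : u i = 0 := by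
    by_contra h
    exact absurd (hN h) (by omega)
  have hrow (j : ℕ) : rowMul u M j = ∑ i ∈ Finset.range N, u (i + 1) * M (i + 1) j :=
    finsum_Ici_one_eq_sum_range _ N fun i hi => by rw [hu0 i hi, zero_mul]
  rw [rowSum, rowSum, finsum_Ici_one_eq_sum_range _ N fun i hi => by rw [hu0 i hi, zero_smul],
    finsum_Ici_one_eq_sum_range _ (4 * N) fun j hj => by
      rw [hrow, Finset.sum_eq_zero, zero_smul]
      intro i hi
      rw [Finset.mem_range] at hi
      rw [hM _ _ (by omega) (by omega), Int.cast_zero, mul_zero], map_sum]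
  simp only [hrow, Nat.add_sub_cancel, map_smul, Finset.sum_smul]
  rw [Finset.sum_comm]
  refine Finset.sum_congr rfl fun i hi => ?_
  rw [Finset.mem_range] at hi
  rw [hL i (4 * N) (by omega), Finset.smul_sum]
  simp only [smul_smul]

/-- The first two identities, in terms of `v0Series`. Each follows from the one before it by a
bisection, through `A` and `B` alternately. -/
theorem v0Series_eq_rowSum (α : ℕ) :
    v0Series (2 * α + 4) = rowSum (xVec (2 * α + 1)) phiQuot ∧
      v0Series (2 * α + 5) = rowSum (xVec (2 * α + 2)) phi2Quot := by
  have step (α : ℕ) (h : v0Series (2 * α + 4) = rowSum (xVec (2 * α + 1)) phiQuot) :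
      v0Series (2 * α + 5) = rowSum (xVec (2 * α + 2)) phi2Quot := by
    rw [show 2 * α + 2 = 2 * (α + 1) by ring, xVec_two_mul (by omega),
      show 2 * (α + 1) - 1 = 2 * α + 1 by omega, ← map_rowSum bisect (finite_support_xVec _)
        matA_eq_zero bisect_phiQuot, ← h, bisect_v0Series]
  have key : v0Series (2 * α + 4) = rowSum (xVec (2 * α + 1)) phiQuot := by
    induction α with
    | zero =>
      rw [rowSum, finsum_Ici_one_eq_sum_range _ 2 fun j hj => by
        simp [xVec, show j ≠ 1 by omega, show j ≠ 2 by omega]]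
      simp [Finset.sum_range_succ, xVec, v0Series_four]
    | succ α ih =>
      rw [xVec_two_mul_add_one (by omega), ← map_rowSum bisect (finite_support_xVec _)
        matB_eq_zero (fun i N hN => bisect_phi2Quot i N (by omega)),
        show 2 * (α + 1) = 2 * α + 2 by ring, ← step α ih, bisect_v0Series]
  exact ⟨key, step α key⟩

end Dissection

end

end MockV0

open MockV0 in
theorem mainTheorem2 (α : ℕ) (hα : 1 ≤ α) :
    (PowerSeries.C (1 / 2 : ℚ) +
        PowerSeries.mk (fun n => if n = 0 then 0 else (MockV0.v0 (2 ^ (2 * α + 2) * n) : ℚ)) =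
      ∑ᶠ j ∈ Set.Ici 1, MockV0.xVec (2 * α - 1) j •
        (MockV0.phi ^ (4 * j - 3) * (MockV0.phiNeg ^ (4 * j - 4))⁻¹)) ∧
    (PowerSeries.C (1 / 2 : ℚ) +
        PowerSeries.mk (fun n => if n = 0 then 0 else (MockV0.v0 (2 ^ (2 * α + 3) * n) : ℚ)) =
      ∑ᶠ j ∈ Set.Ici 1, MockV0.xVec (2 * α) j •
        (MockV0.phi2 ^ (2 * j - 1) * (MockV0.phiNeg ^ (2 * j - 2))⁻¹)) ∧
    (PowerSeries.mk (fun n => (MockV0.v0 (2 ^ (2 * α + 2) * (2 * n + 1)) : ℚ)) =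
      ∑ᶠ j ∈ Set.Ici 1, MockV0.yVec α j •
        (PowerSeries.X ^ (j - 1) * MockV0.psi4 ^ (2 * j - 1) *
          (MockV0.phiNeg ^ (2 * j - 2))⁻¹)) ∧
    (PowerSeries.mk (fun n => (MockV0.v0 (2 ^ (2 * α + 2) * (4 * n + 1)) : ℚ)) =
      ∑ᶠ j ∈ Set.Ici 1, MockV0.zVec α j •
        (PowerSeries.X ^ (j - 1) * MockV0.psi2 ^ (4 * j - 3) *
          (MockV0.phiNeg ^ (4 * j - 4))⁻¹)) := by
  obtain ⟨β, rfl⟩ := Nat.exists_eq_add_of_le' hα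
  obtain ⟨h1, h2⟩ := v0Series_eq_rowSum β
  have h3 : PowerSeries.mk (fun n => (v0 (2 ^ (2 * β + 4) * (2 * n + 1)) : ℚ)) =
      rowSum (yVec (β + 1)) psi4Quot := by
    rw [yVec, ← map_rowSum bisectOdd (finite_support_xVec _) matC_eq_zero bisectOdd_phiQuot,
      show 2 * (β + 1) - 1 = 2 * β + 1 by omega, ← h1]
    ext n
    change _ = PowerSeries.coeff n
      (PowerSeries.mk fun n => PowerSeries.coeff (2 * n + 1) (v0Series (2 * β + 4)))
    simp [v0Series]
  have h4 : PowerSeries.mk (fun n => (v0 (2 ^ (2 * β + 4) * (4 * n + 1)) : ℚ)) =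
      rowSum (zVec (β + 1)) psi2Quot := by
    rw [zVec, ← map_rowSum bisect (finite_support_yVec _) matD_eq_zero
      (fun i N hN => bisect_psi4Quot i N (by omega)), ← h3]
    ext n
    change _ = PowerSeries.coeff n (PowerSeries.mk fun n => PowerSeries.coeff (2 * n)
      (PowerSeries.mk fun n => (v0 (2 ^ (2 * β + 4) * (2 * n + 1)) : ℚ)))
    simp only [PowerSeries.coeff_mk]
    ring_nf
  rw [C_half_add_mk_v0, C_half_add_mk_v0]
  refine ⟨h1.trans ?_, h2.trans ?_, h3.trans ?_, h4.trans ?_⟩ <;>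
    refine finsum_mem_congr rfl fun j (hj : 1 ≤ j) => ?_ <;>
    obtain ⟨j, rfl⟩ := Nat.exists_eq_add_of_le' hj <;>
    rw [phiNeg_pow_inv] <;> rfl
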